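/- **Theorem 8.** Let $r\in(0,1]$, $b>0$, $h\ge 0$, and consider the delayed Belousov–Zhabotinsky system $$u_t(t,x)=\Delta u(t,x)+u(t,x)\bigl(1-u(t,x)-r\,v(t-h,x)\bigr),\qquad v_t(t,x)=\Delta v(t,x)-b\,u(t,x)\,v(t,x). \tag{2}$$ Let $c_\#=c_\#(r,b,h)$ be the unique positive root of the equation $c=2\max\bigl\{\sqrt{1-r},\ \sqrt{b'}/\sqrt{1+b'}\bigr\}$, where $b'=b'(c)=be^{-c^2h/2}$, and let $\omega_*=8.21093\dots$ be the greatest positive root of $\omega=4+2\ln\omega$. Assume that $c\in[2\sqrt{1-r},\,c_\#)$ and that $$c^2\left(\frac{\omega_*}{8r}+\frac h2\right)+\ln\frac{c^2}{4br}-\frac{\omega_*}{2}\,\frac{1-r}{r}>0. \tag{7}$$ Then system (2) has a positive monotone front with velocity $c$ connecting $(0,1)$ with $(1,0)$: there are functions $\phi,\theta:\mathbb R\to(0,\infty)$, $\phi$ non-decreasing and $\theta$ non-increasing, with $(\phi,\theta)(-\infty)=(0,1)$ and $(\phi,\theta)(+\infty)=(1,0)$, such that $(u,v)(t,x)=(\phi,\theta)(\nu\cdot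 x+ct)$ is a classical solution of (2) on $\mathbb R\times\mathbb R^n$ for every $n\ge1$ and every unit vector $\nu\in\mathbb R^n$. Moreover, $(\phi,\theta)$ can be chosen so that, in addition: (i) if $r=1$, then, as $t\to-\infty$, $$\phi(t)=\frac{2c^2/b}{t^2}-\frac{8c}{3b}\Bigl(c^2\bigl(1+h+\tfrac1b\bigr)-4\Bigr)\frac{\ln(-t)}{t^3}+O\Bigl(\frac1{t^3}\Bigr),$$ $$\theta(t)=1+\frac{2c}{t}-\frac43\Bigl(c^2\bigl(1+h+\tfrac1b\bigr)-4\Bigr)\frac{\ln(-t)}{t^2}+O\Bigl(\frac1{t^2}\Bigr); \tag{5}$$ (ii) if $r\in(0,1)$ and $c>2\sqrt{1-r}$, then, for some $\varepsilon>0$ and $\lambda:=\frac12\bigl(c-\sqrt{c^2-4(1-r)}\bigr)$, as $t\to-\infty$, $$\phi(t)=e^{\lambda t}+O\bigl(e^{(\lambda+\varepsilon)t}\bigr),\qquad \theta(t-ch)=1-\frac{b\,e^{\lambda(t-ch)}}{1-r}+O\bigl(e^{(\lambda+\varepsilon)t}\bigr). \tag{6}$$ -/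

import Mathlib

open Filter Topology Asymptotics

/-- `(u, v)` is an entire classical solution, on `ℝ × E`, of the delayed Belousov-Zhabotinsky
system
`u_t(t,x) = Δu(t,x) + u(t,x) (1 - u(t,x) - r v(t-h,x))`, `v_t(t,x) = Δv(t,x) - b u(t,x) v(t,x)`. -/
def IsBZSolution {E : Type*} [NormedAddCommGroup E] [InnerProductSpace ℝ E]
    [FiniteDimensional ℝ E] (r b h : ℝ) (u v : ℝ → E → ℝ) : Prop :=
  ContDiff ℝ 2 (fun p : ℝ × E => u p.1 p.2) ∧
  ContDiff ℝ 2 (fun p : ℝ × E => v p.1 p.2) ∧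
  (∀ (t : ℝ) (x : E), deriv (fun s => u s x) t =
    Laplacian.laplacian (u t) x + u t x * (1 - u t x - r * v (t - h) x)) ∧
  (∀ (t : ℝ) (x : E), deriv (fun s => v s x) t =
    Laplacian.laplacian (v t) x - b * u t x * v t x)

/-- `(φ, θ)` is the profile of a positive monotone front of the delayed Belousov-Zhabotinsky system
with velocity `c`, connecting the equilibrium `(0, 1)` at `-∞` with `(1, 0)` at `+∞`: in every space
dimension and for each unit vector `ν`, the plane wave `(u, v)(t, x) = (φ, θ)(ν ⬝ x + c t)`
is a solution. -/
structure IsPositiveMonotoneFront (r b h c : ℝ) (φ θ : ℝ → ℝ) : Prop where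
  solution : ∀ (n : ℕ) (ν : EuclideanSpace ℝ (Fin n)), ‖ν‖ = 1 →
    IsBZSolution r b h
      (fun (t : ℝ) (x : EuclideanSpace ℝ (Fin n)) => φ (inner ℝ ν x + c * t))
      (fun (t : ℝ) (x : EuclideanSpace ℝ (Fin n)) => θ (inner ℝ ν x + c * t))
  pos_fst : ∀ t, 0 < φ t
  pos_snd : ∀ t, 0 < θ t
  mono_fst : Monotone φ
  anti_snd : Antitone θ
  fst_atBot : Tendsto φ atBot (𝓝 0)
  snd_atBot : Tendsto θ atBot (𝓝 1)
  fst_atTop : Tendsto φ atTop (𝓝 1)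
  snd_atTop : Tendsto θ atTop (𝓝 0)

/-- `b' = b exp(-c² h / 2)`. -/
noncomputable def bPrime (b h c : ℝ) : ℝ := b * Real.exp (-(c ^ 2 * h / 2))

/-- The positive roots of `c = 2 max {√(1 - r), √b' / √(1 + b')}`, `b' = b exp(-c² h / 2)`
(`Real.sqrt` of a negative number is `0`, that is, the real part of the square root). -/
def cSharpRoots (r b h : ℝ) : Set ℝ :=
  {c | 0 < c ∧
    c = 2 * max (Real.sqrt (1 - r)) (Real.sqrt (bPrime b h c) / Real.sqrt (1 + bPrime b h c))}

/-- The unique positive root `c_#(r, b, h)` of `c = 2 max {√(1 - r), √b' / √(1 + b')}`. -/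
noncomputable def cSharp (r b h : ℝ) : ℝ := sSup (cSharpRoots r b h)

/-- The greatest positive root `ω_* = 8.21093…` of `ω = 4 + 2 ln ω`. -/
noncomputable def omegaStar : ℝ := sSup {ω : ℝ | 0 < ω ∧ ω = 4 + 2 * Real.log ω}

/-- `f(s, r, b, h) = s (ω_* / (8 r) + h / 2) + ln (s / (4 b r)) - (ω_* / 2) ((1 - r) / r)`. -/
noncomputable def bzF (s r b h : ℝ) : ℝ :=
  s * (omegaStar / (8 * r) + h / 2) + Real.log (s / (4 * b * r))
    - omegaStar / 2 * ((1 - r) / r)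

/-- The asymptotics at `-∞` in the critical case `r = 1`. -/
def HasCriticalAsymptotics (b h c : ℝ) (φ θ : ℝ → ℝ) : Prop :=
  (fun t => φ t - (2 * c ^ 2 / b / t ^ 2
      - 8 * c / (3 * b) * (c ^ 2 * (1 + h + 1 / b) - 4) * (Real.log (-t) / t ^ 3)))
    =O[atBot] (fun t : ℝ => 1 / t ^ 3) ∧
  (fun t => θ t - (1 + 2 * c / t
      - 4 / 3 * (c ^ 2 * (1 + h + 1 / b) - 4) * (Real.log (-t) / t ^ 2)))
    =O[atBot] (fun t : ℝ => 1 / t ^ 2)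

/-- The smaller root `λ = (c - √(c² - 4 (1 - r))) / 2` of `z² - c z + 1 - r = 0`. -/
noncomputable def slowRate (r c : ℝ) : ℝ := (c - Real.sqrt (c ^ 2 - 4 * (1 - r))) / 2

/-- The asymptotics at `-∞` in the case `r < 1`. The second formula is for the delayed
value `θ (t - c h)`, which is what enters the first profile equation. -/
def HasExponentialAsymptotics (r b h c : ℝ) (φ θ : ℝ → ℝ) : Prop :=
  ∃ ε > 0,
    (fun t => φ t - Real.exp (slowRate r c * t))
      =O[atBot] (fun t => Real.exp ((slowRate r c + ε) * t)) ∧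
    (fun t => θ (t - c * h) - (1 - b * Real.exp (slowRate r c * (t - c * h)) / (1 - r)))
      =O[atBot] (fun t => Real.exp ((slowRate r c + ε) * t))

/-- The equation defining `c_#` has exactly one positive root, and `cSharp` is this root. -/
theorem cSharpRoots_eq {r b h : ℝ} (hb : 0 < b) (hh : 0 ≤ h) :
    cSharpRoots r b h = {cSharp r b h} := by
  set g : ℝ → ℝ := fun c =>
    2 * max (Real.sqrt (1 - r)) (Real.sqrt (bPrime b h c) / Real.sqrt (1 + bPrime b h c)) with hg
  have hbp : ∀ c, 0 < bPrime b h c := fun c => mul_pos hb (Real.exp_pos _)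
  have hgpos : ∀ c, 0 < g c := fun c =>
    mul_pos two_pos (lt_max_of_lt_right
      (div_pos (Real.sqrt_pos.2 (hbp c)) (Real.sqrt_pos.2 (by linarith [hbp c]))))
  have hganti : ∀ x y, 0 ≤ x → x ≤ y → g y ≤ g x := by
    intro x y hx hxy
    have h1 : bPrime b h y ≤ bPrime b h x := by
      refine mul_le_mul_of_nonneg_left (Real.exp_le_exp.2 ?_) hb.le
      have : x ^ 2 * h ≤ y ^ 2 * h := by gcongr
      linarith
    have h2 : Real.sqrt (bPrime b h y) / Real.sqrt (1 + bPrime b h y) ≤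
        Real.sqrt (bPrime b h x) / Real.sqrt (1 + bPrime b h x) := by
      rw [← Real.sqrt_div (hbp y).le, ← Real.sqrt_div (hbp x).le]
      apply Real.sqrt_le_sqrt
      have := hbp x
      have := hbp y
      rw [div_le_div_iff₀ (by linarith) (by linarith)]
      nlinarith
    exact mul_le_mul_of_nonneg_left (max_le_max le_rfl h2) two_pos.le
  have hcont : Continuous g := by
    have hc : Continuous fun c => bPrime b h c := by unfold bPrime; fun_prop
    refine continuous_const.mul (continuous_const.max ?_)
    refine (Real.continuous_sqrt.comp hc).div
      (Real.continuous_sqrt.comp (continuous_const.add hc)) fun c => ?_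
    exact (Real.sqrt_pos.2 (by linarith [hbp c])).ne'
  have huniq : ∀ x ∈ cSharpRoots r b h, ∀ y ∈ cSharpRoots r b h, x ≤ y := by
    rintro x ⟨hx, hxe⟩ y ⟨hy, hye⟩
    by_contra! hlt
    have h1 : g x ≤ g y := hganti y x hy.le hlt.le
    have h2 : x = g x := hxe
    have h3 : y = g y := hye
    linarith
  obtain ⟨c, hc, hce⟩ : ∃ c ∈ Set.Icc 0 (g 0), c - g c = 0 := by
    have := intermediate_value_Icc (hgpos 0).le
      (f := fun c => c - g c) ((continuous_id.sub hcont).continuousOn)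
    exact this ⟨by simpa using (hgpos 0).le,
      by simpa using hganti 0 (g 0) le_rfl (hgpos 0).le⟩
  have hmem : c ∈ cSharpRoots r b h := by
    have h1 : c = g c := by linarith
    exact ⟨by rw [h1]; exact hgpos c, h1⟩
  have hs : cSharpRoots r b h = {c} :=
    Set.eq_singleton_iff_unique_mem.2
      ⟨hmem, fun y hy => le_antisymm (huniq y hy c hmem) (huniq c hmem y hy)⟩
  rw [cSharp, hs, csSup_singleton]

/-- `ω = 4 + 2 ln ω` has a greatest positive root, and `omegaStar` is this root. -/
theorem omegaStar_isGreatest :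
    IsGreatest {ω : ℝ | 0 < ω ∧ ω = 4 + 2 * Real.log ω} omegaStar := by
  have hlog2 := Real.log_two_lt_d9
  have hlog2' := Real.log_two_gt_d9
  obtain ⟨w, hw, hwe⟩ : ∃ w ∈ Set.Icc (8 : ℝ) 16, w - (4 + 2 * Real.log w) = 0 := by
    have hcont : ContinuousOn (fun w : ℝ => w - (4 + 2 * Real.log w)) (Set.Icc 8 16) := by
      refine continuousOn_id.sub (continuousOn_const.add (continuousOn_const.mul
        (Real.continuousOn_log.mono fun x hx => ?_)))
      have : (8 : ℝ) ≤ x := hx.1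
      simp only [Set.mem_compl_iff, Set.mem_singleton_iff]
      linarith
    have h8 : Real.log 8 = 3 * Real.log 2 := by
      rw [show (8 : ℝ) = 2 ^ 3 by norm_num, Real.log_pow]; norm_num
    have h16 : Real.log 16 = 4 * Real.log 2 := by
      rw [show (16 : ℝ) = 2 ^ 4 by norm_num, Real.log_pow]; norm_num
    refine intermediate_value_Icc (by norm_num) hcont ⟨?_, ?_⟩
    · simp only [h8]; linarith
    · simp only [h16]; linarith
  have hw8 : (8 : ℝ) ≤ w := hw.1
  have hgr : IsGreatest {ω : ℝ | 0 < ω ∧ ω = 4 + 2 * Real.log ω} w := by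
    refine ⟨⟨by linarith, by linarith⟩, ?_⟩
    rintro y ⟨hy, hye⟩
    by_contra! hlt
    have h1 : Real.log (y / w) ≤ y / w - 1 := Real.log_le_sub_one_of_pos (by positivity)
    rw [Real.log_div hy.ne' (by linarith)] at h1
    have h2 : y / w - 1 ≤ (y - w) / 8 := by
      rw [div_sub_one (by linarith)]
      exact div_le_div_of_nonneg_left (by linarith) (by norm_num) hw8
    linarith
  rw [omegaStar, hgr.csSup_eq]
  exact hgr

/-! With `ζ = 1 - θ` the profile equations become `φ'' - c φ' + φ (1 - r - φ + r ζ(t - c h)) = 0`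
and `ζ'' - c ζ' + b φ (1 - ζ) = 0`, a cooperative system on `[0,1]²`: each reaction term is
nondecreasing in the other unknown. Shift both by `M = a d` with `d - a = c`, and invert `-(u'' - c
u' - M u)` by its positive Green function. For large `M` this gives a fixed point problem for an
order preserving operator that commutes with translations. Between ordered sub- and supersolutions
the infimum of all monotone supersolutions is a monotone fixed point (`exists_monotone_fixedPoint`),
and the equations force its limits at `+∞` (`isPositiveMonotoneFront_of_fixedPoint`). The pairs are
needed only on half-lines: they are cut off at `1` or `0`, and the maximum principle
`HasDriftLaplacianOn.nonpos` compares the cut-offs with their images.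

It remains to build the pairs. For a noncritical speed, the expected expansion at `-∞`, perturbed by
a slightly smaller term of either sign, gives a "slow" pair, valid only where it is small. The upper
one is carried up to the value `1` by adding a "fast" supersolution: a multiple of `exp (c t / 2)`
in the first component, and in the second an exponential of the same rate continued by its tangent
line. The tangent part works because `exp x * (τ - 1 - x) ≤ 2 τ` for `τ = ω_* / 2`, which is where
the equation for `ω_*` comes from. The condition on `bzF` gives the first inequality with a margin
(`fast_upper_margin`), and this margin pays for the cross terms of the sum. The lower pair is
brought down to `0` by subtracting multiples of `exp (c t / 2)`. All corrections are `O(exp (c t /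
2))`, so the asymptotics of the slow pair survive.

The slow pairs are `exp (λ t) ± exp ((λ + ε) t)` for `r < 1`, and expansions in powers of `(-t) ^
(-1/2)` and `ln (-t)` for `r = 1`. At the critical speed with `r < 1`, multiples of `-t exp (c t /
2)` form an upper pair directly. -/

open MeasureTheory Set

/-! ### The drift Laplacian and a maximum principle. -/

/-- `E = Y'' - c Y'` on `(-∞, t₀)`, where `Y''` may be just the left derivative of `Y'`. -/
def HasDriftLaplacianOn (c t₀ : ℝ) (Y E : ℝ → ℝ) : Prop :=
  ∃ Y' : ℝ → ℝ, ∀ t < t₀, HasDerivAt Y (Y' t) t ∧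
    HasDerivWithinAt Y' (E t + c * Y' t) (Iic t) t

namespace HasDriftLaplacianOn

variable {c t₀ : ℝ} {Y Z E F : ℝ → ℝ}

theorem add (hY : HasDriftLaplacianOn c t₀ Y E) (hZ : HasDriftLaplacianOn c t₀ Z F) :
    HasDriftLaplacianOn c t₀ (fun t => Y t + Z t) (fun t => E t + F t) := by
  obtain ⟨Y', hY⟩ := hY
  obtain ⟨Z', hZ⟩ := hZ
  refine ⟨fun t => Y' t + Z' t, fun t ht => ⟨(hY t ht).1.add (hZ t ht).1, ?_⟩⟩
  exact ((hY t ht).2.add (hZ t ht).2).congr_deriv (by ring)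

theorem const_mul (k : ℝ) (hY : HasDriftLaplacianOn c t₀ Y E) :
    HasDriftLaplacianOn c t₀ (fun t => k * Y t) (fun t => k * E t) := by
  obtain ⟨Y', hY⟩ := hY
  refine ⟨fun t => k * Y' t, fun t ht => ⟨(hY t ht).1.const_mul k, ?_⟩⟩
  exact ((hY t ht).2.const_mul k).congr_deriv (by ring)

theorem sub (hY : HasDriftLaplacianOn c t₀ Y E) (hZ : HasDriftLaplacianOn c t₀ Z F) :
    HasDriftLaplacianOn c t₀ (fun t => Y t - Z t) (fun t => E t - F t) := by
  have := hY.add (hZ.const_mul (-1))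
  simpa [sub_eq_add_neg] using this

theorem mono {t₁ : ℝ} (hY : HasDriftLaplacianOn c t₀ Y E) (h : t₁ ≤ t₀) :
    HasDriftLaplacianOn c t₁ Y E := by
  obtain ⟨Y', hY⟩ := hY
  exact ⟨Y', fun t ht => hY t (ht.trans_le h)⟩

theorem of_hasDerivAt {Y' Y'' : ℝ → ℝ} (h1 : ∀ t < t₀, HasDerivAt Y (Y' t) t)
    (h2 : ∀ t < t₀, HasDerivAt Y' (Y'' t) t) :
    HasDriftLaplacianOn c t₀ Y (fun t => Y'' t - c * Y' t) :=
  ⟨Y', fun t ht => ⟨h1 t ht, (h2 t ht).hasDerivWithinAt.congr_deriv (by ring)⟩⟩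

theorem exp (c t₀ μ : ℝ) :
    HasDriftLaplacianOn c t₀ (fun t => Real.exp (μ * t))
      (fun t => (μ ^ 2 - c * μ) * Real.exp (μ * t)) := by
  have h : ∀ t, HasDerivAt (fun t => Real.exp (μ * t)) (Real.exp (μ * t) * μ) t := fun t =>
    (((hasDerivAt_id t).const_mul μ).exp).congr_deriv (by simp)
  refine ⟨fun t => Real.exp (μ * t) * μ, fun t _ => ⟨h t, ?_⟩⟩
  exact ((h t).mul_const μ).hasDerivWithinAt.congr_deriv (by ring)

theorem congr {Y₂ E₂ : ℝ → ℝ} (hY : HasDriftLaplacianOn c t₀ Y E) (h : Y₂ = Y)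
    (hE : ∀ t < t₀, E₂ t = E t) : HasDriftLaplacianOn c t₀ Y₂ E₂ := by
  obtain ⟨Y', hY⟩ := hY
  subst h
  exact ⟨Y', fun t ht => ⟨(hY t ht).1, by rw [hE t ht]; exact (hY t ht).2⟩⟩

theorem comp_add_const (N : ℝ) (hY : HasDriftLaplacianOn c t₀ Y E) :
    HasDriftLaplacianOn c (t₀ - N) (fun t => Y (t + N)) (fun t => E (t + N)) := by
  obtain ⟨Y', hY⟩ := hY
  refine ⟨fun t => Y' (t + N), fun t ht => ?_⟩
  have h := hY (t + N) (by linarith)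
  refine ⟨h.1.comp_add_const t N, ?_⟩
  have := h.2.scomp t (((hasDerivAt_id t).add_const N).hasDerivWithinAt (s := Iic t))
    (fun x hx => by simpa using hx)
  exact this.congr_deriv (by simp)

/-- A maximum principle on a half-line. -/
theorem nonpos (hY : HasDriftLaplacianOn c t₀ Y E) (hcont : ContinuousOn Y (Iic t₀))
    (hbot : Tendsto Y atBot (𝓝 0)) (h0 : Y t₀ ≤ 0) (hE : ∀ t < t₀, 0 < Y t → 0 < E t) :
    ∀ t ≤ t₀, Y t ≤ 0 := by
  obtain ⟨Y', hY⟩ := hY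
  intro t₁ ht₁
  by_contra! hpos
  obtain ⟨S, hS⟩ := ((hbot.eventually (gt_mem_nhds hpos)).and (eventually_lt_atBot t₁)).exists
  -- The maximum over `[S, t₀]` is interior: `Y S < Y t₁` by the choice of `S`, and `Y t₀ ≤ 0`.
  obtain ⟨t, ⟨hSt, htt⟩, hmax⟩ := isCompact_Icc.exists_isMaxOn
    (nonempty_Icc.2 (hS.2.le.trans ht₁)) (hcont.mono (fun x (hx : x ∈ Icc S t₀) => hx.2))
  have hYt : Y t₁ ≤ Y t := hmax ⟨hS.2.le, ht₁⟩
  have hSt' : S < t := lt_of_le_of_ne hSt (by rintro rfl; linarith [hS.1])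
  have htt' : t < t₀ := lt_of_le_of_ne htt (by rintro rfl; linarith)
  have hloc : IsLocalMax Y t := hmax.isLocalMax (Icc_mem_nhds hSt' htt')
  have hd0 : Y' t = 0 := hloc.hasDerivAt_eq_zero (hY t htt').1
  have hd2 := (hY t htt').2
  rw [hd0, mul_zero, add_zero] at hd2
  -- At the maximum `Y'` vanishes and has left derivative `E t > 0`, so `Y' < 0` just before `t` and
  -- `Y` would decrease into its maximum. Only left derivatives enter, so `Y'` may have corners.
  have hneg : ∀ᶠ x in 𝓝[<] t, Y' x < 0 := by
    have h1 := (hasDerivWithinAt_iff_tendsto_slope.1 hd2)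
    rw [Iic_sdiff_right] at h1
    filter_upwards [h1.eventually (lt_mem_nhds (hE t htt' (hpos.trans_le hYt))),
      self_mem_nhdsWithin] with x hx hxt
    rw [slope_def_field, hd0, sub_zero] at hx
    by_contra! hge
    have : Y' x / (x - t) ≤ 0 := div_nonpos_of_nonneg_of_nonpos hge (by
      have : x < t := hxt
      linarith)
    linarith
  obtain ⟨l, hl, hlt⟩ := (mem_nhdsLT_iff_exists_Ioo_subset' hSt').1 hneg
  set m := max l S with hm
  have hmt : m < t := max_lt hl hSt'
  have hanti : StrictAntiOn Y (Icc m t) := by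
    refine strictAntiOn_of_deriv_neg (convex_Icc _ _) (hcont.mono fun x hx => hx.2.trans htt) ?_
    intro x hx
    rw [interior_Icc] at hx
    rw [((hY x (hx.2.trans htt')).1).deriv]
    exact hlt ⟨(le_max_left _ _).trans_lt hx.1, hx.2⟩
  have h1 := hanti (left_mem_Icc.2 hmt.le) (right_mem_Icc.2 hmt.le) hmt
  have h2 : Y m ≤ Y t := hmax ⟨le_max_right _ _, hmt.le.trans htt⟩
  linarith

end HasDriftLaplacianOn

/-! ### Exponential convolutions and the Green operator. -/

/-- `F` is measurable and takes values in `[0, C]`. -/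
def IsBddSource (C : ℝ) (F : ℝ → ℝ) : Prop := Measurable F ∧ ∀ t, F t ∈ Icc 0 C

/-- Convolution with `exp (-a σ)` on the half-line. -/
noncomputable def expConv (a : ℝ) (F : ℝ → ℝ) (t : ℝ) : ℝ :=
  ∫ σ in Ioi (0 : ℝ), Real.exp (-a * σ) * F (t - σ)

section expConv

variable {a C : ℝ} {F H : ℝ → ℝ}

theorem IsBddSource.comp (hF : IsBddSource C F) {g : ℝ → ℝ} (hg : Measurable g) :
    IsBddSource C (fun t => F (g t)) := ⟨hF.1.comp hg, fun t => hF.2 (g t)⟩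

theorem integrableOn_expConv (ha : 0 < a) (hF : IsBddSource C F) (t : ℝ) :
    IntegrableOn (fun σ => Real.exp (-a * σ) * F (t - σ)) (Ioi 0) := by
  refine Integrable.mul_bdd (c := C) (integrableOn_exp_mul_Ioi (by linarith) 0) ?_ ?_
  · exact (hF.1.comp (by fun_prop : Measurable fun σ : ℝ => t - σ)).aestronglyMeasurable
  · refine Eventually.of_forall fun σ => ?_
    rw [Real.norm_eq_abs, abs_of_nonneg (hF.2 _).1]
    exact (hF.2 _).2

theorem integral_exp_neg_mul_Ioi (ha : 0 < a) :
    ∫ σ in Ioi (0 : ℝ), Real.exp (-a * σ) = 1 / a := by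
  rw [integral_exp_mul_Ioi (by linarith)]
  simp

theorem expConv_mono (ha : 0 < a) {C' : ℝ} (hF : IsBddSource C F) (hH : IsBddSource C' H) {t t' : ℝ}
    (h : ∀ σ > 0, F (t - σ) ≤ H (t' - σ)) : expConv a F t ≤ expConv a H t' := by
  refine setIntegral_mono_on (integrableOn_expConv ha hF t) (integrableOn_expConv ha hH t')
    measurableSet_Ioi fun σ hσ => ?_
  exact mul_le_mul_of_nonneg_left (h σ hσ) (Real.exp_pos _).le

/-- Dominated convergence. Translation invariance of `l`, in the form `hl`, lets one proof serve
both ends of the line. -/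
theorem expConv_tendsto (ha : 0 < a) (hF : IsBddSource C F) {l : Filter ℝ} {L : ℝ}
    [l.IsCountablyGenerated] (hl : ∀ σ : ℝ, Tendsto (fun t => t - σ) l l) (h : Tendsto F l (𝓝 L)) :
    Tendsto (expConv a F) l (𝓝 (L / a)) := by
  have h1 : ∫ σ in Ioi (0 : ℝ), Real.exp (-a * σ) * L = L / a := by
    rw [integral_mul_const, integral_exp_neg_mul_Ioi ha]; ring
  rw [← h1]
  refine tendsto_integral_filter_of_dominated_convergence (fun σ => Real.exp (-a * σ) * C)
    ?_ ?_ ?_ ?_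
  · exact Eventually.of_forall fun t => (integrableOn_expConv ha hF t).aestronglyMeasurable
  · refine Eventually.of_forall fun t => Eventually.of_forall fun σ => ?_
    rw [Real.norm_eq_abs, abs_of_nonneg (mul_nonneg (Real.exp_pos _).le (hF.2 _).1)]
    exact mul_le_mul_of_nonneg_left (hF.2 _).2 (Real.exp_pos _).le
  · exact Integrable.mul_const (integrableOn_exp_mul_Ioi (by linarith) 0) C
  · refine Eventually.of_forall fun σ => ?_
    exact (h.comp (hl σ)).const_mul _

theorem expConv_eq_integral_Iic (a : ℝ) (F : ℝ → ℝ) (t : ℝ) :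
    expConv a F t = Real.exp (-a * t) * ∫ s in Iic t, Real.exp (a * s) * F s := by
  have h1 : expConv a F t = ∫ σ in Ici (0 : ℝ), Real.exp (-a * σ) * F (t - σ) :=
    (integral_Ici_eq_integral_Ioi).symm
  rw [h1, ← integral_const_mul, ← integral_indicator measurableSet_Ici,
    ← integral_indicator measurableSet_Iic, ← integral_sub_left_eq_self _ volume t]
  congr 1
  ext σ
  simp only [indicator, mem_Ici, mem_Iic, sub_nonneg, sub_sub_cancel]
  split_ifs
  · rw [← mul_assoc, ← Real.exp_add]
    congr 2
    ring
  · rfl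

theorem integrableOn_exp_mul_Iic_source (ha : 0 < a) (hF : IsBddSource C F) (t : ℝ) :
    IntegrableOn (fun s => Real.exp (a * s) * F s) (Iic t) := by
  refine Integrable.mul_bdd (c := C) (integrableOn_exp_mul_Iic ha t) ?_ ?_
  · exact hF.1.aestronglyMeasurable
  · refine Eventually.of_forall fun σ => ?_
    rw [Real.norm_eq_abs, abs_of_nonneg (hF.2 _).1]
    exact (hF.2 _).2

/-- Takes `t` out of the integrand, so that continuity and differentiability become those of a
primitive. -/
theorem expConv_eq_primitive (ha : 0 < a) (hF : IsBddSource C F) (t : ℝ) :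
    expConv a F t = Real.exp (-a * t) *
      ((∫ s in Iic 0, Real.exp (a * s) * F s) + ∫ s in (0)..t, Real.exp (a * s) * F s) := by
  rw [expConv_eq_integral_Iic, ← intervalIntegral.integral_Iic_sub_Iic
    (integrableOn_exp_mul_Iic_source ha hF 0) (integrableOn_exp_mul_Iic_source ha hF t)]
  ring_nf

theorem continuous_expConv (ha : 0 < a) (hF : IsBddSource C F) : Continuous (expConv a F) := by
  rw [show expConv a F = _ from funext (expConv_eq_primitive ha hF)]
  refine (by fun_prop : Continuous fun t => Real.exp (-a * t)).mul (continuous_const.add ?_)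
  refine intervalIntegral.continuous_primitive (fun x y => ?_) 0
  exact ⟨(integrableOn_exp_mul_Iic_source ha hF y).mono_set Ioc_subset_Iic_self,
    (integrableOn_exp_mul_Iic_source ha hF x).mono_set Ioc_subset_Iic_self⟩

theorem hasDerivAt_expConv (ha : 0 < a) (hF : IsBddSource C F) (hc : Continuous F) (t : ℝ) :
    HasDerivAt (expConv a F) (F t - a * expConv a F t) t := by
  have h1 : HasDerivAt (fun t => ∫ s in (0)..t, Real.exp (a * s) * F s)
      (Real.exp (a * t) * F t) t :=
    intervalIntegral.integral_hasDerivAt_right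
      (Continuous.intervalIntegrable (by fun_prop) _ _)
      (Continuous.stronglyMeasurableAtFilter (by fun_prop) _ _)
      (Continuous.continuousAt (by fun_prop))
  have h2 : HasDerivAt (fun t => Real.exp (-a * t)) (Real.exp (-a * t) * -a) t :=
    (((hasDerivAt_id t).const_mul (-a)).exp).congr_deriv (by simp)
  have h3 := h2.mul (h1.const_add (∫ s in Iic 0, Real.exp (a * s) * F s))
  rw [show expConv a F = _ from funext (expConv_eq_primitive ha hF)]
  refine h3.congr_deriv ?_
  have : Real.exp (-a * t) * Real.exp (a * t) = 1 := by rw [← Real.exp_add]; simp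
  simp only
  linear_combination F t * this

theorem expConv_pos (ha : 0 < a) (hF : IsBddSource C F) {S t : ℝ} (h : ∀ s < S, 0 < F s) :
    0 < expConv a F t := by
  rw [expConv, setIntegral_pos_iff_support_of_nonneg_ae _ (integrableOn_expConv ha hF t)]
  · have hsub : Ioi (max 0 (t - S)) ⊆
        Function.support (fun σ => Real.exp (-a * σ) * F (t - σ)) ∩ Ioi 0 := by
      intro σ hσ
      have h0 := max_lt_iff.1 (mem_Ioi.1 hσ)
      exact ⟨(mul_pos (Real.exp_pos _) (h _ (by linarith))).ne', h0.1⟩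
    exact (by simp : (0 : ENNReal) < volume (Ioi (max 0 (t - S)))).trans_le (measure_mono hsub)
  · exact Eventually.of_forall fun σ => mul_nonneg (Real.exp_pos _).le (hF.2 _).1

end expConv

/-- The Green operator of `-(u'' - (d - a) u' - a d u)` on bounded functions. -/
noncomputable def green (a d : ℝ) (F : ℝ → ℝ) (t : ℝ) : ℝ :=
  (expConv a F t + expConv d (fun s => F (-s)) (-t)) / (a + d)

section green

variable {a d C : ℝ} {F H : ℝ → ℝ}

theorem green_mono (ha : 0 < a) (hd : 0 < d) {C' : ℝ} (hF : IsBddSource C F)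
    (hH : IsBddSource C' H) {t t' : ℝ} (h : ∀ σ, F (t - σ) ≤ H (t' - σ)) :
    green a d F t ≤ green a d H t' := by
  refine div_le_div_of_nonneg_right (add_le_add (expConv_mono ha hF hH fun σ _ => h σ)
    (expConv_mono hd (hF.comp measurable_neg) (hH.comp measurable_neg) fun σ _ => ?_))
    (by positivity)
  simpa [sub_eq_add_neg, add_comm] using h (-σ)

theorem green_const (ha : 0 < a) (hd : 0 < d) (k t : ℝ) :
    green a d (fun _ => k) t = k / (a * d) := by
  rw [green, expConv, expConv, integral_mul_const, integral_mul_const,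
    integral_exp_neg_mul_Ioi ha, integral_exp_neg_mul_Ioi hd]
  field_simp
  ring

theorem green_nonneg (ha : 0 < a) (hd : 0 < d) (hF : IsBddSource C F) (t : ℝ) :
    0 ≤ green a d F t := by
  have := green_mono ha hd (C := 0) (F := fun _ => 0) (t := t) ⟨measurable_const, by simp⟩ hF
    (t' := t) fun σ => (hF.2 _).1
  rwa [green_const ha hd, zero_div] at this

theorem green_le (ha : 0 < a) (hd : 0 < d) (hF : IsBddSource C F) (t : ℝ) :
    green a d F t ≤ C / (a * d) := by
  have h0 : 0 ≤ C := (hF.2 0).1.trans (hF.2 0).2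
  have := green_mono ha hd (t := t) hF (C' := C) (H := fun _ => C)
    ⟨measurable_const, fun _ => ⟨h0, le_rfl⟩⟩ (t' := t) fun σ => (hF.2 _).2
  rwa [green_const ha hd] at this

/-- The backward half of the kernel is enough: it sees all of `(-∞, t)`, hence some points to the
left of `S`. -/
theorem green_pos (ha : 0 < a) (hd : 0 < d) (hF : IsBddSource C F) {S : ℝ}
    (h : ∀ s < S, 0 < F s) (t : ℝ) : 0 < green a d F t := by
  refine div_pos (add_pos_of_pos_of_nonneg (expConv_pos ha hF h) ?_) (by positivity)
  exact integral_nonneg fun σ => mul_nonneg (Real.exp_pos _).le (hF.2 _).1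

theorem continuous_green (ha : 0 < a) (hd : 0 < d) (hF : IsBddSource C F) :
    Continuous (green a d F) :=
  ((continuous_expConv ha hF).add
    ((continuous_expConv hd (hF.comp measurable_neg)).comp continuous_neg)).div_const _

theorem green_tendsto (ha : 0 < a) (hd : 0 < d) (hF : IsBddSource C F) {L : ℝ} :
    (Tendsto F atTop (𝓝 L) → Tendsto (green a d F) atTop (𝓝 (L / (a * d)))) ∧
    (Tendsto F atBot (𝓝 L) → Tendsto (green a d F) atBot (𝓝 (L / (a * d)))) := by
  have e : L / (a * d) = (L / a + L / d) / (a + d) := by field_simp; ring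
  rw [e]
  have hT : ∀ σ : ℝ, Tendsto (fun t => t - σ) atTop atTop := fun σ =>
    tendsto_atTop_add_const_right _ _ tendsto_id
  have hB : ∀ σ : ℝ, Tendsto (fun t => t - σ) atBot atBot := fun σ =>
    tendsto_atBot_add_const_right _ _ tendsto_id
  refine ⟨fun h => ?_, fun h => ?_⟩
  · exact ((expConv_tendsto ha hF hT h).add ((expConv_tendsto hd (hF.comp measurable_neg) hB
      (h.comp tendsto_neg_atBot_atTop)).comp tendsto_neg_atTop_atBot)).div_const _
  · exact ((expConv_tendsto ha hF hB h).add ((expConv_tendsto hd (hF.comp measurable_neg) hT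
      (h.comp tendsto_neg_atTop_atBot)).comp tendsto_neg_atBot_atTop)).div_const _

/-- The derivative of `green a d F`. -/
noncomputable def greenDeriv (a d : ℝ) (F : ℝ → ℝ) (t : ℝ) : ℝ :=
  (d * expConv d (fun s => F (-s)) (-t) - a * expConv a F t) / (a + d)

theorem hasDerivAt_expConv_reflect (hd : 0 < d) (hF : IsBddSource C F) (hc : Continuous F) (t : ℝ) :
    HasDerivAt (fun t => expConv d (fun s => F (-s)) (-t))
      (d * expConv d (fun s => F (-s)) (-t) - F t) t := by
  have h := (hasDerivAt_expConv hd (hF.comp measurable_neg) (hc.comp continuous_neg) (-t))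
  have := h.comp t (hasDerivAt_neg t)
  refine this.congr_deriv ?_
  simp

theorem hasDerivAt_green (ha : 0 < a) (hd : 0 < d) (hF : IsBddSource C F) (hc : Continuous F)
    (t : ℝ) : HasDerivAt (green a d F) (greenDeriv a d F t) t := by
  refine (((hasDerivAt_expConv ha hF hc t).add
    (hasDerivAt_expConv_reflect hd hF hc t)).div_const (a + d)).congr_deriv ?_
  rw [greenDeriv]
  ring

theorem hasDerivAt_greenDeriv (ha : 0 < a) (hd : 0 < d) (hF : IsBddSource C F) (hc : Continuous F)
    (t : ℝ) : HasDerivAt (greenDeriv a d F)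
      ((d - a) * greenDeriv a d F t + a * d * green a d F t - F t) t := by
  refine ((((hasDerivAt_expConv_reflect hd hF hc t).const_mul d).sub
    ((hasDerivAt_expConv ha hF hc t).const_mul a)).div_const (a + d)).congr_deriv ?_
  rw [greenDeriv, green]
  field_simp
  ring

theorem green_hasDriftLaplacianOn (ha : 0 < a) (hd : 0 < d) (hF : IsBddSource C F)
    (hc : Continuous F) (t₀ : ℝ) :
    HasDriftLaplacianOn (d - a) t₀ (green a d F) (fun t => a * d * green a d F t - F t) :=
  ⟨greenDeriv a d F, fun t _ => ⟨hasDerivAt_green ha hd hF hc t,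
    (hasDerivAt_greenDeriv ha hd hF hc t).hasDerivWithinAt.congr_deriv (by ring)⟩⟩

end green

theorem green_sub {a d C C' : ℝ} {F H : ℝ → ℝ} (ha : 0 < a) (hd : 0 < d) (hF : IsBddSource C F)
    (hH : IsBddSource C' H) (t : ℝ) :
    green a d (fun s => F s - H s) t = green a d F t - green a d H t := by
  simp only [green, expConv, mul_sub]
  rw [integral_sub (integrableOn_expConv ha hF t) (integrableOn_expConv ha hH t),
    integral_sub (integrableOn_expConv hd (hF.comp measurable_neg) (-t))
      (integrableOn_expConv hd (hH.comp measurable_neg) (-t))]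
  ring

/-! ### Order preserving reaction terms and the monotone fixed point. -/

/-- The right-hand side of the first profile equation, shifted by `M y`. -/
def sourceFst (M r k : ℝ) (y z : ℝ → ℝ) (t : ℝ) : ℝ := y t * (M + 1 - r - y t + r * z (t - k))

/-- The right-hand side of the second profile equation, shifted by `M z`. -/
def sourceSnd (M b : ℝ) (y z : ℝ → ℝ) (t : ℝ) : ℝ := M * z t + b * y t * (1 - z t)

section source

variable {M r b k : ℝ} {y z y' z' : ℝ → ℝ}

/-- The increment is `(u' - u)(M + 1 - r - u - u' + r v) + r u' (v' - v)`, and `M ≥ 2` keeps the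
first bracket nonnegative on `[0,1]`. -/
theorem mul_reaction_le (hr0 : 0 < r) (hr1 : r ≤ 1) (hM : 2 ≤ M) {u v u' v' : ℝ}
    (hu : 0 ≤ u) (huu : u ≤ u') (hu' : u' ≤ 1) (hv : 0 ≤ v) (hvv : v ≤ v') :
    u * (M + 1 - r - u + r * v) ≤ u' * (M + 1 - r - u' + r * v') := by
  have h1 : 0 ≤ (u' - u) * (M + 1 - r - u - u' + r * v) := by
    have := mul_nonneg hr0.le hv
    exact mul_nonneg (by linarith) (by linarith)
  have h2 : 0 ≤ u' * (r * (v' - v)) := by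
    have : 0 ≤ v' - v := by linarith
    have : 0 ≤ u' := by linarith
    positivity
  linarith

theorem isBddSource_sourceFst (hr0 : 0 < r) (hr1 : r ≤ 1) (hM : 2 ≤ M) (hy : IsBddSource 1 y)
    (hz : IsBddSource 1 z) : IsBddSource M (sourceFst M r k y z) := by
  refine ⟨?_, fun t => ⟨?_, ?_⟩⟩
  · have h1 := hy.1
    have h2 : Measurable fun t => z (t - k) := hz.1.comp (by fun_prop)
    exact h1.mul ((h1.const_sub _).add (h2.const_mul r))
  · have h1 := (hy.2 t).2
    have h2 := mul_nonneg hr0.le (hz.2 (t - k)).1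
    exact mul_nonneg (hy.2 t).1 (by linarith)
  · have := mul_reaction_le hr0 hr1 hM (hy.2 t).1 (hy.2 t).2 le_rfl (hz.2 (t - k)).1
      (hz.2 (t - k)).2
    unfold sourceFst
    linarith

theorem isBddSource_sourceSnd (hb : 0 < b) (hbM : b ≤ M) (hy : IsBddSource 1 y)
    (hz : IsBddSource 1 z) : IsBddSource M (sourceSnd M b y z) := by
  refine ⟨?_, fun t => ⟨?_, ?_⟩⟩
  · have h1 := hy.1
    have h2 := hz.1
    unfold sourceSnd
    fun_prop
  · have h1 := mul_nonneg (hb.trans_le hbM).le (hz.2 t).1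
    have h2 := mul_nonneg (mul_nonneg hb.le (hy.2 t).1) (sub_nonneg.2 (hz.2 t).2)
    unfold sourceSnd
    linarith
  · have h1 : b * y t ≤ M := by nlinarith [(hy.2 t).1, (hy.2 t).2]
    have h2 := mul_le_mul_of_nonneg_right h1 (sub_nonneg.2 (hz.2 t).2)
    unfold sourceSnd
    linarith

theorem sourceFst_le (hr0 : 0 < r) (hr1 : r ≤ 1) (hM : 2 ≤ M) (hy : IsBddSource 1 y)
    (hy' : IsBddSource 1 y') (hz : IsBddSource 1 z) {s t : ℝ} (h1 : y s ≤ y' t)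
    (h2 : z (s - k) ≤ z' (t - k)) : sourceFst M r k y z s ≤ sourceFst M r k y' z' t :=
  mul_reaction_le hr0 hr1 hM (hy.2 s).1 h1 (hy'.2 t).2 (hz.2 _).1 h2

/-- The increment is `(M - b y)(z' - z) + b (y' - y)(1 - z')`. -/
theorem sourceSnd_le (hb : 0 < b) (hbM : b ≤ M) (hy : IsBddSource 1 y)
    (hz' : IsBddSource 1 z') {s t : ℝ} (h1 : y s ≤ y' t)
    (h2 : z s ≤ z' t) : sourceSnd M b y z s ≤ sourceSnd M b y' z' t := by
  unfold sourceSnd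
  have h3 : b * y s ≤ M := by nlinarith [(hy.2 s).1, (hy.2 s).2]
  have h4 := mul_nonneg (sub_nonneg.2 h3) (sub_nonneg.2 h2)
  have h5 := mul_nonneg (mul_nonneg hb.le (sub_nonneg.2 h1)) (sub_nonneg.2 (hz'.2 t).2)
  linarith

end source

/-- A monotone fixed point of the integral system between ordered sub- and supersolutions. -/
theorem exists_monotone_fixedPoint {a d r b k : ℝ} {ym zm yp zp : ℝ → ℝ} (ha : 0 < a) (hd : 0 < d)
    (hr0 : 0 < r) (hr1 : r ≤ 1) (hM : 2 ≤ a * d) (hb : 0 < b) (hbM : b ≤ a * d)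
    (hym : IsBddSource 1 ym) (hzm : IsBddSource 1 zm) (hyp : IsBddSource 1 yp)
    (hzp : IsBddSource 1 zp) (hypm : Monotone yp) (hzpm : Monotone zp)
    (hy : ym ≤ yp) (hz : zm ≤ zp)
    (hyp' : green a d (sourceFst (a * d) r k yp zp) ≤ yp)
    (hzp' : green a d (sourceSnd (a * d) b yp zp) ≤ zp)
    (hym' : ym ≤ green a d (sourceFst (a * d) r k ym zm))
    (hzm' : zm ≤ green a d (sourceSnd (a * d) b ym zm)) :
    ∃ y z : ℝ → ℝ, Monotone y ∧ Monotone z ∧ ym ≤ y ∧ y ≤ yp ∧ zm ≤ z ∧ z ≤ zp ∧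
      y = green a d (sourceFst (a * d) r k y z) ∧ z = green a d (sourceSnd (a * d) b y z) := by
  -- Knaster–Tarski on the monotone supersolutions above the lower pair; no continuity of the
  -- operator is needed. Monotonicity passes to the infimum, and it also makes this uncountable
  -- infimum measurable.
  set S : Set ((ℝ → ℝ) × (ℝ → ℝ)) := {p | Monotone p.1 ∧ Monotone p.2 ∧ ym ≤ p.1 ∧ p.1 ≤ yp ∧
    zm ≤ p.2 ∧ p.2 ≤ zp ∧ green a d (sourceFst (a * d) r k p.1 p.2) ≤ p.1 ∧
    green a d (sourceSnd (a * d) b p.1 p.2) ≤ p.2} with hS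
  have hpS : (yp, zp) ∈ S := ⟨hypm, hzpm, hy, le_rfl, hz, le_rfl, hyp', hzp'⟩
  have hne : Nonempty S := ⟨⟨_, hpS⟩⟩
  have hby : ∀ t, BddBelow (range fun p : S => p.1.1 t) := fun t =>
    ⟨ym t, by rintro _ ⟨p, rfl⟩; exact p.2.2.2.1 t⟩
  have hbz : ∀ t, BddBelow (range fun p : S => p.1.2 t) := fun t =>
    ⟨zm t, by rintro _ ⟨p, rfl⟩; exact p.2.2.2.2.2.1 t⟩
  set y : ℝ → ℝ := fun t => ⨅ p : S, p.1.1 t with hydef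
  set z : ℝ → ℝ := fun t => ⨅ p : S, p.1.2 t with hzdef
  have hyle : ∀ p ∈ S, y ≤ p.1 := fun p hp t => ciInf_le (hby t) (⟨p, hp⟩ : S)
  have hzle : ∀ p ∈ S, z ≤ p.2 := fun p hp t => ciInf_le (hbz t) (⟨p, hp⟩ : S)
  have hymon : Monotone y := fun s t hst => le_ciInf fun p =>
    (ciInf_le (hby s) p).trans (p.2.1 hst)
  have hzmon : Monotone z := fun s t hst => le_ciInf fun p =>
    (ciInf_le (hbz s) p).trans (p.2.2.1 hst)
  have hymy : ym ≤ y := fun t => le_ciInf fun p => p.2.2.2.1 t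
  have hzmz : zm ≤ z := fun t => le_ciInf fun p => p.2.2.2.2.2.1 t
  have hbdd : ∀ {f g e : ℝ → ℝ}, Monotone f → IsBddSource 1 g → IsBddSource 1 e → g ≤ f → f ≤ e →
      IsBddSource 1 f := fun hf hg he h1 h2 =>
    ⟨hf.measurable, fun t => ⟨(hg.2 t).1.trans (h1 t), (h2 t).trans (he.2 t).2⟩⟩
  have hyb : IsBddSource 1 y := hbdd hymon hym hyp hymy (hyle _ hpS)
  have hzb : IsBddSource 1 z := hbdd hzmon hzm hzp hzmz (hzle _ hpS)
  have hF : IsBddSource (a * d) (sourceFst (a * d) r k y z) :=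
    isBddSource_sourceFst hr0 hr1 hM hyb hzb
  have hH : IsBddSource (a * d) (sourceSnd (a * d) b y z) := isBddSource_sourceSnd hb hbM hyb hzb
  set Ty := green a d (sourceFst (a * d) r k y z) with hTy
  set Tz := green a d (sourceSnd (a * d) b y z) with hTz
  have hTyy : Ty ≤ y := fun t => le_ciInf fun p => by
    have hpy := hbdd p.2.1 hym hyp p.2.2.2.1 p.2.2.2.2.1
    have hpz := hbdd p.2.2.1 hzm hzp p.2.2.2.2.2.1 p.2.2.2.2.2.2.1
    exact (green_mono ha hd hF (isBddSource_sourceFst hr0 hr1 hM hpy hpz) fun σ =>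
      sourceFst_le hr0 hr1 hM hyb hpy hzb (hyle _ p.2 _) (hzle _ p.2 _)).trans
      (p.2.2.2.2.2.2.2.1 t)
  have hTzz : Tz ≤ z := fun t => le_ciInf fun p => by
    have hpy := hbdd p.2.1 hym hyp p.2.2.2.1 p.2.2.2.2.1
    have hpz := hbdd p.2.2.1 hzm hzp p.2.2.2.2.2.1 p.2.2.2.2.2.2.1
    exact (green_mono ha hd hH (isBddSource_sourceSnd hb hbM hpy hpz) fun σ =>
      sourceSnd_le hb hbM hyb hpz (hyle _ p.2 _) (hzle _ p.2 _)).trans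
      (p.2.2.2.2.2.2.2.2 t)
  have hymT : ym ≤ Ty := fun t => (hym' t).trans (green_mono ha hd
    (isBddSource_sourceFst hr0 hr1 hM hym hzm) hF fun σ =>
      sourceFst_le hr0 hr1 hM hym hyb hzm (hymy _) (hzmz _))
  have hzmT : zm ≤ Tz := fun t => (hzm' t).trans (green_mono ha hd
    (isBddSource_sourceSnd hb hbM hym hzm) hH fun σ =>
      sourceSnd_le hb hbM hym hzb (hymy _) (hzmz _))
  -- The operator commutes with translations, so it preserves monotonicity in `t`.
  have hTym : Monotone Ty := fun s t hst => green_mono ha hd hF hF fun σ =>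
    sourceFst_le hr0 hr1 hM hyb hyb hzb (hymon (by linarith)) (hzmon (by linarith))
  have hTzm : Monotone Tz := fun s t hst => green_mono ha hd hH hH fun σ =>
    sourceSnd_le hb hbM hyb hzb (hymon (by linarith)) (hzmon (by linarith))
  have hTyb : IsBddSource 1 Ty := hbdd hTym hym hyb hymT hTyy
  have hTzb : IsBddSource 1 Tz := hbdd hTzm hzm hzb hzmT hTzz
  -- The image of the infimum lies below it and is again in `S`, hence also above it.
  have hTS : (Ty, Tz) ∈ S := ⟨hTym, hTzm, hymT, hTyy.trans (hyle _ hpS), hzmT,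
    hTzz.trans (hzle _ hpS),
    fun t => green_mono ha hd (isBddSource_sourceFst hr0 hr1 hM hTyb hTzb) hF fun σ =>
      sourceFst_le hr0 hr1 hM hTyb hyb hTzb (hTyy _) (hTzz _),
    fun t => green_mono ha hd (isBddSource_sourceSnd hb hbM hTyb hTzb) hH fun σ =>
      sourceSnd_le hb hbM hTyb hzb (hTyy _) (hTzz _)⟩
  exact ⟨y, z, hymon, hzmon, hymy, hyle _ hpS, hzmz, hzle _ hpS,
    le_antisymm (hyle _ hTS) hTyy, le_antisymm (hzle _ hTS) hTzz⟩

/-! ### Regularity of Green potentials and plane waves. -/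

theorem contDiff_two_green {a d C : ℝ} {F : ℝ → ℝ} (ha : 0 < a) (hd : 0 < d)
    (hF : IsBddSource C F) (hc : Continuous F) :
    ContDiff ℝ 2 (green a d F) ∧ ∀ t, deriv (deriv (green a d F)) t =
      (d - a) * deriv (green a d F) t + a * d * green a d F t - F t := by
  have h1 : deriv (green a d F) = greenDeriv a d F :=
    funext fun t => (hasDerivAt_green ha hd hF hc t).deriv
  have h2 : deriv (greenDeriv a d F) = fun t =>
      (d - a) * greenDeriv a d F t + a * d * green a d F t - F t :=
    funext fun t => (hasDerivAt_greenDeriv ha hd hF hc t).deriv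
  have hg' : Differentiable ℝ (greenDeriv a d F) := fun t =>
    (hasDerivAt_greenDeriv ha hd hF hc t).differentiableAt
  refine ⟨?_, fun t => by rw [h1, h2]⟩
  rw [show (2 : WithTop ℕ∞) = 1 + 1 from by norm_num, contDiff_succ_iff_deriv]
  refine ⟨fun t => (hasDerivAt_green ha hd hF hc t).differentiableAt, by simp, ?_⟩
  rw [h1, contDiff_one_iff_deriv]
  refine ⟨hg', ?_⟩
  rw [h2]
  have := hg'.continuous
  have := continuous_green ha hd hF
  fun_prop

theorem laplacian_planeWave {n : ℕ} (ν : EuclideanSpace ℝ (Fin n)) (hν : ‖ν‖ = 1) {φ : ℝ → ℝ}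
    (hφ : ContDiff ℝ 2 φ) (k : ℝ) (x : EuclideanSpace ℝ (Fin n)) :
    Laplacian.laplacian (fun x : EuclideanSpace ℝ (Fin n) => φ (inner ℝ ν x + k)) x =
      deriv (deriv φ) (inner ℝ ν x + k) := by
  have hd1 : Differentiable ℝ φ := hφ.differentiable (by norm_num)
  have hd2 : Differentiable ℝ (deriv φ) := by
    have : ContDiff ℝ 1 (deriv φ) := ((contDiff_succ_iff_deriv (n := 1)).1
      (by norm_num; exact hφ)).2.2
    exact this.differentiable (by norm_num)
  have hl : ∀ x : EuclideanSpace ℝ (Fin n),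
      HasFDerivAt (fun x : EuclideanSpace ℝ (Fin n) => inner ℝ ν x + k) (innerSL ℝ ν) x :=
    fun x => (innerSL ℝ ν).hasFDerivAt.add_const k
  have h1 : fderiv ℝ (fun x : EuclideanSpace ℝ (Fin n) => φ (inner ℝ ν x + k)) =
      fun x => deriv φ (inner ℝ ν x + k) • innerSL ℝ ν := by
    ext1 x
    exact ((hd1 _).hasDerivAt.comp_hasFDerivAt x (hl x)).fderiv
  have h2 : ∀ x, HasFDerivAt (fun x : EuclideanSpace ℝ (Fin n) =>
      deriv φ (inner ℝ ν x + k) • innerSL ℝ ν)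
      ((deriv (deriv φ) (inner ℝ ν x + k) • innerSL ℝ ν).smulRight (innerSL ℝ ν)) x := fun x =>
    (show HasFDerivAt (fun x : EuclideanSpace ℝ (Fin n) => deriv φ (inner ℝ ν x + k))
      (deriv (deriv φ) (inner ℝ ν x + k) • innerSL ℝ ν) x from
      (hd2 _).hasDerivAt.comp_hasFDerivAt x (hl x)).smul_const (innerSL ℝ ν)
  rw [congr_fun (InnerProductSpace.laplacian_eq_iteratedFDeriv_orthonormalBasis _
    (EuclideanSpace.basisFun (Fin n) ℝ)) x]
  simp only [iteratedFDeriv_two_apply, h1, (h2 x).fderiv]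
  -- Parseval: the squared coordinates of `ν` sum to `1`.
  have h3 := (EuclideanSpace.basisFun (Fin n) ℝ).sum_sq_norm_inner_left ν
  rw [hν] at h3
  simp only [Real.norm_eq_abs, sq_abs] at h3
  simp only [Matrix.cons_val_zero, Matrix.cons_val_one, ContinuousLinearMap.smulRight_apply,
    smul_apply, innerSL_apply_apply, smul_eq_mul]
  rw [show (1 : ℝ) ^ 2 = 1 by norm_num] at h3
  trans deriv (deriv φ) (inner ℝ ν x + k) *
    ∑ i, inner ℝ ν (EuclideanSpace.basisFun (Fin n) ℝ i) ^ 2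
  · rw [Finset.mul_sum]
    exact Finset.sum_congr rfl fun i _ => by ring
  · rw [h3, mul_one]

/-- Solutions of the profile equations give plane wave solutions. -/
theorem isBZSolution_planeWave {r b h c : ℝ} {φ θ : ℝ → ℝ} (hφ : ContDiff ℝ 2 φ)
    (hθ : ContDiff ℝ 2 θ)
    (h1 : ∀ t, deriv (deriv φ) t = c * deriv φ t - φ t * (1 - φ t - r * θ (t - c * h)))
    (h2 : ∀ t, deriv (deriv θ) t = c * deriv θ t + b * φ t * θ t)
    (n : ℕ) (ν : EuclideanSpace ℝ (Fin n)) (hν : ‖ν‖ = 1) :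
    IsBZSolution r b h
      (fun (t : ℝ) (x : EuclideanSpace ℝ (Fin n)) => φ (inner ℝ ν x + c * t))
      (fun (t : ℝ) (x : EuclideanSpace ℝ (Fin n)) => θ (inner ℝ ν x + c * t)) := by
  have hlin : ContDiff ℝ 2 (fun p : ℝ × EuclideanSpace ℝ (Fin n) => inner ℝ ν p.2 + c * p.1) :=
    ((innerSL ℝ ν).contDiff.comp contDiff_snd).add (contDiff_const.mul contDiff_fst)
  have hder : ∀ {f : ℝ → ℝ}, ContDiff ℝ 2 f → ∀ (t k : ℝ),
      deriv (fun s => f (k + c * s)) t = c * deriv f (k + c * t) := fun {f} hf t k => by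
    have hl : HasDerivAt (fun s : ℝ => k + c * s) c t :=
      (((hasDerivAt_id t).const_mul c).const_add k).congr_deriv (by simp)
    have hd : DifferentiableAt ℝ f (k + c * t) := hf.differentiable (by norm_num) _
    exact (hd.hasDerivAt.comp t hl).deriv.trans (mul_comm _ _)
  refine ⟨hφ.comp hlin, hθ.comp hlin, fun t x => ?_, fun t x => ?_⟩
  · rw [hder hφ, laplacian_planeWave ν hν hφ, h1,
      show inner ℝ ν x + c * t - c * h = inner ℝ ν x + c * (t - h) by ring]
    ring
  · rw [hder hθ, laplacian_planeWave ν hν hθ, h2]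
    ring

/-! ### Upper and lower pairs, their cut-offs and the comparison with their images. -/

/-- An ordered pair of supersolutions of the profile equations for `(φ, 1 - θ)` on `(-∞, t₀]`,
to be cut off at the value `1`. -/
structure IsUpperPair (r b k c t₀ : ℝ) (Y Z : ℝ → ℝ) : Prop where
  cont_fst : ContinuousOn Y (Iic t₀)
  cont_snd : ContinuousOn Z (Iic t₀)
  mono_fst : MonotoneOn Y (Iic t₀)
  mono_snd : MonotoneOn Z (Iic t₀)
  nonneg_fst : ∀ t ≤ t₀, 0 ≤ Y t
  nonneg_snd : ∀ t ≤ t₀, 0 ≤ Z t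
  one_le_fst : 1 ≤ Y t₀
  one_le_snd : 1 ≤ Z t₀
  tendsto_fst : Tendsto Y atBot (𝓝 0)
  tendsto_snd : Tendsto Z atBot (𝓝 0)
  eqn_fst : ∃ E, HasDriftLaplacianOn c t₀ Y E ∧
    ∀ t < t₀, E t + Y t * (1 - r - Y t + r * Z (t - k)) ≤ 0
  eqn_snd : ∃ E, HasDriftLaplacianOn c t₀ Z E ∧
    ∀ t < t₀, Z t < 1 → E t + b * Y t * (1 - Z t) ≤ 0

/-- A pair of subsolutions of the profile equations for `(φ, 1 - θ)` on `(-∞, t₀]`,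
to be cut off at the value `0`. -/
structure IsLowerPair (r b k c t₀ : ℝ) (Y Z : ℝ → ℝ) : Prop where
  cont_fst : ContinuousOn Y (Iic t₀)
  cont_snd : ContinuousOn Z (Iic t₀)
  le_one_fst : ∀ t ≤ t₀, Y t ≤ 1
  le_one_snd : ∀ t ≤ t₀, Z t ≤ 1
  nonpos_fst : Y t₀ ≤ 0
  nonpos_snd : Z t₀ ≤ 0
  tendsto_fst : Tendsto Y atBot (𝓝 0)
  tendsto_snd : Tendsto Z atBot (𝓝 0)
  pos_fst : ∀ᶠ t in atBot, 0 < Y t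
  eqn_fst : ∃ E, HasDriftLaplacianOn c t₀ Y E ∧
    ∀ t < t₀, 0 < Y t → 0 ≤ E t + Y t * (1 - r - Y t + r * Z (t - k))
  eqn_snd : ∃ E, HasDriftLaplacianOn c t₀ Z E ∧
    ∀ t < t₀, 0 < Z t → 0 ≤ E t + b * Y t * (1 - Z t)

/-- `min 1 Y` on `(-∞, t₀]`, extended by a constant. -/
noncomputable def cutAbove (t₀ : ℝ) (Y : ℝ → ℝ) (t : ℝ) : ℝ := min 1 (Y (min t t₀))

/-- `max 0 Y` on `(-∞, t₀]`, extended by a constant. -/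
noncomputable def cutBelow (t₀ : ℝ) (Y : ℝ → ℝ) (t : ℝ) : ℝ := max 0 (Y (min t t₀))

section cut

variable {t₀ : ℝ} {Y : ℝ → ℝ}

theorem continuous_comp_min (h : ContinuousOn Y (Iic t₀)) : Continuous fun t => Y (min t t₀) :=
  h.comp_continuous (by fun_prop) fun t => min_le_right t t₀

theorem continuous_cutAbove (h : ContinuousOn Y (Iic t₀)) : Continuous (cutAbove t₀ Y) :=
  continuous_const.min (continuous_comp_min h)

theorem continuous_cutBelow (h : ContinuousOn Y (Iic t₀)) : Continuous (cutBelow t₀ Y) :=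
  continuous_const.max (continuous_comp_min h)

theorem cutAbove_le {t : ℝ} (ht : t ≤ t₀) : cutAbove t₀ Y t ≤ Y t := by
  rw [cutAbove, min_eq_left ht]
  exact min_le_right _ _

theorem le_cutBelow {t : ℝ} (ht : t ≤ t₀) : Y t ≤ cutBelow t₀ Y t := by
  rw [cutBelow, min_eq_left ht]
  exact le_max_right _ _

theorem isBddSource_cutAbove (h : ContinuousOn Y (Iic t₀)) (h0 : ∀ t ≤ t₀, 0 ≤ Y t) :
    IsBddSource 1 (cutAbove t₀ Y) :=
  ⟨(continuous_cutAbove h).measurable,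
    fun _ => ⟨le_min zero_le_one (h0 _ (min_le_right _ _)), min_le_left _ _⟩⟩

theorem isBddSource_cutBelow (h : ContinuousOn Y (Iic t₀)) (h1 : ∀ t ≤ t₀, Y t ≤ 1) :
    IsBddSource 1 (cutBelow t₀ Y) :=
  ⟨(continuous_cutBelow h).measurable,
    fun _ => ⟨le_max_left _ _, max_le zero_le_one (h1 _ (min_le_right _ _))⟩⟩

theorem monotone_cutAbove (h : MonotoneOn Y (Iic t₀)) : Monotone (cutAbove t₀ Y) :=
  fun _ _ hst => min_le_min_left _ (h (mem_Iic.2 (min_le_right _ _))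
    (mem_Iic.2 (min_le_right _ _)) (min_le_min_right _ hst))

theorem tendsto_cutAbove (h : Tendsto Y atBot (𝓝 0)) : Tendsto (cutAbove t₀ Y) atBot (𝓝 0) := by
  have : Tendsto (fun t => min 1 (Y t)) atBot (𝓝 (min 1 0)) := tendsto_const_nhds.min h
  rw [min_eq_right zero_le_one] at this
  refine this.congr' ?_
  filter_upwards [eventually_le_atBot t₀] with t ht
  rw [cutAbove, min_eq_left ht]

theorem tendsto_cutBelow (h : Tendsto Y atBot (𝓝 0)) : Tendsto (cutBelow t₀ Y) atBot (𝓝 0) := by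
  have : Tendsto (fun t => max 0 (Y t)) atBot (𝓝 (max 0 0)) := tendsto_const_nhds.max h
  rw [max_self] at this
  refine this.congr' ?_
  filter_upwards [eventually_le_atBot t₀] with t ht
  rw [cutBelow, min_eq_left ht]

theorem cutAbove_eq_one (h : 1 ≤ Y t₀) {t : ℝ} (ht : t₀ ≤ t) : cutAbove t₀ Y t = 1 := by
  rw [cutAbove, min_eq_right ht, min_eq_left h]

theorem cutBelow_eq_zero (h : Y t₀ ≤ 0) {t : ℝ} (ht : t₀ ≤ t) : cutBelow t₀ Y t = 0 := by
  rw [cutBelow, min_eq_right ht, max_eq_left h]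

end cut

theorem tendsto_sourceFst {M r k : ℝ} {y z : ℝ → ℝ} {l : Filter ℝ} {u v : ℝ}
    (hl : Tendsto (fun t => t - k) l l) (hy : Tendsto y l (𝓝 u)) (hz : Tendsto z l (𝓝 v)) :
    Tendsto (sourceFst M r k y z) l (𝓝 (u * (M + 1 - r - u + r * v))) :=
  hy.mul ((hy.const_sub _).add ((hz.comp hl).const_mul r))

theorem tendsto_sourceSnd {M b : ℝ} {y z : ℝ → ℝ} {l : Filter ℝ} {u v : ℝ}
    (hy : Tendsto y l (𝓝 u)) (hz : Tendsto z l (𝓝 v)) :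
    Tendsto (sourceSnd M b y z) l (𝓝 (M * v + b * u * (1 - v))) :=
  (hz.const_mul M).add ((hy.const_mul b).mul (hz.const_sub 1))

theorem continuous_sourceFst {M r k : ℝ} {y z : ℝ → ℝ} (hy : Continuous y) (hz : Continuous z) :
    Continuous (sourceFst M r k y z) := by
  unfold sourceFst
  fun_prop

theorem continuous_sourceSnd {M b : ℝ} {y z : ℝ → ℝ} (hy : Continuous y) (hz : Continuous z) :
    Continuous (sourceSnd M b y z) := by
  unfold sourceSnd
  fun_prop

theorem tendsto_sub_const_atBot (k : ℝ) : Tendsto (fun t : ℝ => t - k) atBot atBot :=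
  tendsto_atBot_add_const_right _ _ tendsto_id

theorem tendsto_sub_const_atTop (k : ℝ) : Tendsto (fun t : ℝ => t - k) atTop atTop :=
  tendsto_atTop_add_const_right _ _ tendsto_id

section comparison

variable {a d r b k c t₀ : ℝ} {Y Z : ℝ → ℝ}

/-- Where `Y ≥ 1`, the bound `a d / (a d) = 1` on the Green potential `u` suffices. At a point with
`u > Y` one has `Y < 1`, the cut-offs are at most `Y` and `Z`, and the drift Laplacian of `u - Y` is
at least `a d (u - Y) > 0`, so the maximum principle applies. No matching of derivatives at the cut
is required. The other three comparisons follow the same scheme. -/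
theorem IsUpperPair.green_sourceFst_le (hp : IsUpperPair r b k c t₀ Y Z) (ha : 0 < a) (hd : 0 < d)
    (hc : d - a = c) (hr0 : 0 < r) (hr1 : r ≤ 1) (hM : 2 ≤ a * d) (hk : 0 ≤ k) :
    green a d (sourceFst (a * d) r k (cutAbove t₀ Y) (cutAbove t₀ Z)) ≤ cutAbove t₀ Y := by
  have hyb := isBddSource_cutAbove hp.cont_fst hp.nonneg_fst
  have hzb := isBddSource_cutAbove hp.cont_snd hp.nonneg_snd
  set F := sourceFst (a * d) r k (cutAbove t₀ Y) (cutAbove t₀ Z) with hFdef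
  have hF : IsBddSource (a * d) F := isBddSource_sourceFst hr0 hr1 hM hyb hzb
  have hFc : Continuous F := continuous_sourceFst (continuous_cutAbove hp.cont_fst)
    (continuous_cutAbove hp.cont_snd)
  have hle1 : ∀ t, green a d F t ≤ 1 := fun t =>
    (green_le ha hd hF t).trans (div_self (by positivity)).le
  have hbot : Tendsto (green a d F) atBot (𝓝 0) := by
    have h := tendsto_sourceFst (M := a * d) (r := r) (tendsto_sub_const_atBot k)
      (tendsto_cutAbove (t₀ := t₀) hp.tendsto_fst) (tendsto_cutAbove (t₀ := t₀) hp.tendsto_snd)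
    simpa using (green_tendsto ha hd hF).2 h
  obtain ⟨E, hE, hineq⟩ := hp.eqn_fst
  have hD := (green_hasDriftLaplacianOn ha hd hF hFc t₀)
  rw [hc] at hD
  have key := (hD.sub hE).nonpos ((continuous_green ha hd hF).continuousOn.sub hp.cont_fst)
    (by simpa using hbot.sub hp.tendsto_fst) (by linarith [hle1 t₀, hp.one_le_fst])
    (fun t ht hpos => by
      have h1 : Y t < 1 := by linarith [hle1 t]
      have h2 : cutAbove t₀ Y t = Y t := by
        rw [cutAbove, min_eq_left ht.le, min_eq_right h1.le]
      have h3 : cutAbove t₀ Z (t - k) ≤ Z (t - k) := cutAbove_le (by linarith)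
      have h4 : F t ≤ Y t * (a * d + 1 - r - Y t + r * Z (t - k)) := by
        rw [hFdef, sourceFst, h2]
        have := hp.nonneg_fst t ht.le
        gcongr
      have h5 := hineq t ht
      have h6 : 0 < a * d * (green a d F t - Y t) := mul_pos (by positivity) hpos
      linarith)
  intro t
  rcases le_total t t₀ with ht | ht
  · rw [cutAbove, min_eq_left ht]
    exact le_min (hle1 t) (by linarith [key t ht])
  · rw [cutAbove_eq_one hp.one_le_fst ht]
    exact hle1 t

theorem IsUpperPair.green_sourceSnd_le (hp : IsUpperPair r b k c t₀ Y Z) (ha : 0 < a) (hd : 0 < d)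
    (hc : d - a = c) (hb : 0 < b) (hbM : b ≤ a * d) :
    green a d (sourceSnd (a * d) b (cutAbove t₀ Y) (cutAbove t₀ Z)) ≤ cutAbove t₀ Z := by
  have hyb := isBddSource_cutAbove hp.cont_fst hp.nonneg_fst
  have hzb := isBddSource_cutAbove hp.cont_snd hp.nonneg_snd
  set F := sourceSnd (a * d) b (cutAbove t₀ Y) (cutAbove t₀ Z) with hFdef
  have hF : IsBddSource (a * d) F := isBddSource_sourceSnd hb hbM hyb hzb
  have hFc : Continuous F := continuous_sourceSnd (continuous_cutAbove hp.cont_fst)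
    (continuous_cutAbove hp.cont_snd)
  have hle1 : ∀ t, green a d F t ≤ 1 := fun t =>
    (green_le ha hd hF t).trans (div_self (by positivity)).le
  have hbot : Tendsto (green a d F) atBot (𝓝 0) := by
    have h := tendsto_sourceSnd (M := a * d) (b := b)
      (tendsto_cutAbove (t₀ := t₀) hp.tendsto_fst) (tendsto_cutAbove (t₀ := t₀) hp.tendsto_snd)
    simpa using (green_tendsto ha hd hF).2 h
  obtain ⟨E, hE, hineq⟩ := hp.eqn_snd
  have hD := (green_hasDriftLaplacianOn ha hd hF hFc t₀)
  rw [hc] at hD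
  have key := (hD.sub hE).nonpos ((continuous_green ha hd hF).continuousOn.sub hp.cont_snd)
    (by simpa using hbot.sub hp.tendsto_snd) (by linarith [hle1 t₀, hp.one_le_snd])
    (fun t ht hpos => by
      have h1 : Z t < 1 := by linarith [hle1 t]
      have h2 : cutAbove t₀ Z t = Z t := by
        rw [cutAbove, min_eq_left ht.le, min_eq_right h1.le]
      have h3 : cutAbove t₀ Y t ≤ Y t := cutAbove_le ht.le
      have h4 : F t ≤ a * d * Z t + b * Y t * (1 - Z t) := by
        rw [hFdef, sourceSnd, h2]
        have := sub_nonneg.2 h1.le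
        gcongr
      have h5 := hineq t ht h1
      have h6 : 0 < a * d * (green a d F t - Z t) := mul_pos (by positivity) hpos
      linarith)
  intro t
  rcases le_total t t₀ with ht | ht
  · rw [cutAbove, min_eq_left ht]
    exact le_min (hle1 t) (by linarith [key t ht])
  · rw [cutAbove_eq_one hp.one_le_snd ht]
    exact hle1 t

theorem IsLowerPair.le_green_sourceFst (hp : IsLowerPair r b k c t₀ Y Z) (ha : 0 < a) (hd : 0 < d)
    (hc : d - a = c) (hr0 : 0 < r) (hr1 : r ≤ 1) (hM : 2 ≤ a * d) (hk : 0 ≤ k) :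
    cutBelow t₀ Y ≤ green a d (sourceFst (a * d) r k (cutBelow t₀ Y) (cutBelow t₀ Z)) := by
  have hyb := isBddSource_cutBelow hp.cont_fst hp.le_one_fst
  have hzb := isBddSource_cutBelow hp.cont_snd hp.le_one_snd
  set F := sourceFst (a * d) r k (cutBelow t₀ Y) (cutBelow t₀ Z) with hFdef
  have hF : IsBddSource (a * d) F := isBddSource_sourceFst hr0 hr1 hM hyb hzb
  have hFc : Continuous F := continuous_sourceFst (continuous_cutBelow hp.cont_fst)
    (continuous_cutBelow hp.cont_snd)
  have hnn : ∀ t, 0 ≤ green a d F t := green_nonneg ha hd hF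
  have hbot : Tendsto (green a d F) atBot (𝓝 0) := by
    have h := tendsto_sourceFst (M := a * d) (r := r) (tendsto_sub_const_atBot k)
      (tendsto_cutBelow (t₀ := t₀) hp.tendsto_fst) (tendsto_cutBelow (t₀ := t₀) hp.tendsto_snd)
    simpa using (green_tendsto ha hd hF).2 h
  obtain ⟨E, hE, hineq⟩ := hp.eqn_fst
  have hD := (green_hasDriftLaplacianOn ha hd hF hFc t₀)
  rw [hc] at hD
  have key := (hE.sub hD).nonpos (hp.cont_fst.sub (continuous_green ha hd hF).continuousOn)
    (by simpa using hp.tendsto_fst.sub hbot) (by linarith [hnn t₀, hp.nonpos_fst])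
    (fun t ht hpos => by
      have h1 : 0 < Y t := by linarith [hnn t]
      have h2 : cutBelow t₀ Y t = Y t := by
        rw [cutBelow, min_eq_left ht.le, max_eq_right h1.le]
      have h3 : Z (t - k) ≤ cutBelow t₀ Z (t - k) := le_cutBelow (by linarith)
      have h4 : Y t * (a * d + 1 - r - Y t + r * Z (t - k)) ≤ F t := by
        rw [hFdef, sourceFst, h2]
        gcongr
      have h5 := hineq t ht h1
      have h6 : 0 < a * d * (Y t - green a d F t) := mul_pos (by positivity) hpos
      linarith)
  intro t
  rcases le_total t t₀ with ht | ht
  · rw [cutBelow, min_eq_left ht]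
    exact max_le (hnn t) (by linarith [key t ht])
  · rw [cutBelow_eq_zero hp.nonpos_fst ht]
    exact hnn t

theorem IsLowerPair.le_green_sourceSnd (hp : IsLowerPair r b k c t₀ Y Z) (ha : 0 < a) (hd : 0 < d)
    (hc : d - a = c) (hb : 0 < b) (hbM : b ≤ a * d) :
    cutBelow t₀ Z ≤ green a d (sourceSnd (a * d) b (cutBelow t₀ Y) (cutBelow t₀ Z)) := by
  have hyb := isBddSource_cutBelow hp.cont_fst hp.le_one_fst
  have hzb := isBddSource_cutBelow hp.cont_snd hp.le_one_snd
  set F := sourceSnd (a * d) b (cutBelow t₀ Y) (cutBelow t₀ Z) with hFdef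
  have hF : IsBddSource (a * d) F := isBddSource_sourceSnd hb hbM hyb hzb
  have hFc : Continuous F := continuous_sourceSnd (continuous_cutBelow hp.cont_fst)
    (continuous_cutBelow hp.cont_snd)
  have hnn : ∀ t, 0 ≤ green a d F t := green_nonneg ha hd hF
  have hbot : Tendsto (green a d F) atBot (𝓝 0) := by
    have h := tendsto_sourceSnd (M := a * d) (b := b)
      (tendsto_cutBelow (t₀ := t₀) hp.tendsto_fst) (tendsto_cutBelow (t₀ := t₀) hp.tendsto_snd)
    simpa using (green_tendsto ha hd hF).2 h
  obtain ⟨E, hE, hineq⟩ := hp.eqn_snd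
  have hD := (green_hasDriftLaplacianOn ha hd hF hFc t₀)
  rw [hc] at hD
  have key := (hE.sub hD).nonpos (hp.cont_snd.sub (continuous_green ha hd hF).continuousOn)
    (by simpa using hp.tendsto_snd.sub hbot) (by linarith [hnn t₀, hp.nonpos_snd])
    (fun t ht hpos => by
      have h1 : 0 < Z t := by linarith [hnn t]
      have h2 : cutBelow t₀ Z t = Z t := by
        rw [cutBelow, min_eq_left ht.le, max_eq_right h1.le]
      have h3 : Y t ≤ cutBelow t₀ Y t := le_cutBelow ht.le
      have h4 : a * d * Z t + b * Y t * (1 - Z t) ≤ F t := by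
        rw [hFdef, sourceSnd, h2]
        have := sub_nonneg.2 (hp.le_one_snd t ht.le)
        gcongr
      have h5 := hineq t ht h1
      have h6 : 0 < a * d * (Z t - green a d F t) := mul_pos (by positivity) hpos
      linarith)
  intro t
  rcases le_total t t₀ with ht | ht
  · rw [cutBelow, min_eq_left ht]
    exact max_le (hnn t) (by linarith [key t ht])
  · rw [cutBelow_eq_zero hp.nonpos_snd ht]
    exact hnn t

end comparison

/-! ### From fixed points to fronts. -/

/-- Monotone fixed points of the integral system are profiles of positive monotone fronts. -/
theorem isPositiveMonotoneFront_of_fixedPoint {a d r b h : ℝ} {y z : ℝ → ℝ} (ha : 0 < a)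
    (hd : 0 < d) (hr0 : 0 < r) (hr1 : r ≤ 1) (hM : 2 ≤ a * d) (hb : 0 < b) (hbM : b < a * d)
    (hyb : IsBddSource 1 y) (hzb : IsBddSource 1 z) (hym : Monotone y) (hzm : Monotone z)
    (hy0 : Tendsto y atBot (𝓝 0)) (hz0 : Tendsto z atBot (𝓝 0)) (hpos : ∀ᶠ t in atBot, 0 < y t)
    (hy : y = green a d (sourceFst (a * d) r ((d - a) * h) y z))
    (hz : z = green a d (sourceSnd (a * d) b y z)) :
    IsPositiveMonotoneFront r b h (d - a) y (fun t => 1 - z t) := by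
  have hF : IsBddSource (a * d) (sourceFst (a * d) r ((d - a) * h) y z) :=
    isBddSource_sourceFst hr0 hr1 hM hyb hzb
  have hH : IsBddSource (a * d) (sourceSnd (a * d) b y z) :=
    isBddSource_sourceSnd hb hbM.le hyb hzb
  have hyc : Continuous y := by rw [hy]; exact continuous_green ha hd hF
  have hzc : Continuous z := by rw [hz]; exact continuous_green ha hd hH
  obtain ⟨hyC, hyE⟩ := contDiff_two_green ha hd hF (continuous_sourceFst hyc hzc)
  obtain ⟨hzC, hzE⟩ := contDiff_two_green ha hd hH (continuous_sourceSnd hyc hzc)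
  rw [← hy] at hyC hyE
  rw [← hz] at hzC hzE
  have hMpos : 0 < a * d := mul_pos ha hd
  have hypos : ∀ t, 0 < y t := fun t => by
    obtain ⟨s, hs, hst⟩ := (hpos.and (eventually_le_atBot t)).exists
    exact hs.trans_le (hym hst)
  have hytop : Tendsto y atTop (𝓝 (⨆ t, y t)) :=
    tendsto_atTop_ciSup hym ⟨1, by rintro _ ⟨t, rfl⟩; exact (hyb.2 t).2⟩
  have hztop : Tendsto z atTop (𝓝 (⨆ t, z t)) :=
    tendsto_atTop_ciSup hzm ⟨1, by rintro _ ⟨t, rfl⟩; exact (hzb.2 t).2⟩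
  set u := ⨆ t, y t with hu
  set v := ⨆ t, z t with hv
  have hupos : 0 < u := (hypos 0).trans_le (hym.ge_of_tendsto hytop 0)
  -- Passing to the limit in the integral equations makes `(u, v)` an equilibrium; since `u > 0`, it
  -- can only be `(1, 1)`.
  have hueq : u = u * (a * d + 1 - r - u + r * v) / (a * d) := by
    have := (green_tendsto ha hd hF).1
      (tendsto_sourceFst (tendsto_sub_const_atTop _) hytop hztop)
    rw [← hy] at this
    exact tendsto_nhds_unique hytop this
  have hveq : v = (a * d * v + b * u * (1 - v)) / (a * d) := by
    have := (green_tendsto ha hd hH).1 (tendsto_sourceSnd hytop hztop)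
    rw [← hz] at this
    exact tendsto_nhds_unique hztop this
  have hv1 : v = 1 := by
    rw [eq_div_iff hMpos.ne'] at hveq
    have : b * u * (1 - v) = 0 := by linarith
    rcases mul_eq_zero.1 this with h0 | h0
    · exact absurd h0 (by positivity)
    · linarith
  have hu1 : u = 1 := by
    rw [eq_div_iff hMpos.ne', hv1] at hueq
    have : u * (1 - u) = 0 := by linarith
    rcases mul_eq_zero.1 this with h0 | h0
    · exact absurd h0 hupos.ne'
    · linarith
  have hzlt : ∀ t, 0 < 1 - z t := by
    intro t
    have hK : IsBddSource (a * d) (fun _ : ℝ => a * d) :=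
      ⟨measurable_const, fun _ => ⟨hMpos.le, le_rfl⟩⟩
    -- `1 - z` is the Green potential of `(a d - b y)(1 - z)`, which is positive near `-∞`; the
    -- strict inequality `b < a d` enters here.
    have hfac : ∀ s, a * d - sourceSnd (a * d) b y z s = (a * d - b * y s) * (1 - z s) := by
      intro s
      unfold sourceSnd
      ring
    have hby : ∀ s, 0 < a * d - b * y s := fun s => by
      nlinarith [(hyb.2 s).1, (hyb.2 s).2]
    have hG : IsBddSource (a * d) (fun s => a * d - sourceSnd (a * d) b y z s) := by
      refine ⟨measurable_const.sub hH.1, fun s => ⟨?_, ?_⟩⟩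
      · linarith [(hH.2 s).2]
      · linarith [(hH.2 s).1]
    obtain ⟨S, hS⟩ := (hz0.eventually (gt_mem_nhds zero_lt_one)).exists
    have h1 := green_pos ha hd hG (S := S) (fun s hs => by
      rw [hfac]
      exact mul_pos (hby s) (sub_pos.2 ((hzm hs.le).trans_lt hS))) t
    rw [green_sub ha hd hK hH, green_const ha hd, div_self hMpos.ne', ← hz] at h1
    exact h1
  have hθC : ContDiff ℝ 2 fun t => 1 - z t := contDiff_const.sub hzC
  have hd1 : deriv (fun t => 1 - z t) = fun t => -deriv z t := by
    ext t
    simp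
  have hd2 : ∀ t, deriv (deriv fun t => 1 - z t) t = -deriv (deriv z) t := fun t => by
    rw [hd1]
    simp
  refine ⟨fun n ν hν => isBZSolution_planeWave hyC hθC (fun t => ?_) (fun t => ?_) n ν hν, hypos,
    hzlt, hym, fun s t hst => sub_le_sub_left (hzm hst) 1, hy0, by simpa using hz0.const_sub 1,
    by rwa [hu1] at hytop, by simpa [hv1] using hztop.const_sub 1⟩
  · rw [hyE, sourceFst]
    ring
  · rw [hd2, hzE, hd1, sourceSnd]
    ring

/-- Existence of a front between ordered lower and upper pairs. -/
theorem exists_front_of_pairs {r b h c t₀ s₀ : ℝ} {Y Z y z : ℝ → ℝ} (hr0 : 0 < r) (hr1 : r ≤ 1)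
    (hb : 0 < b) (hh : 0 ≤ h) (hc : 0 < c) (hU : IsUpperPair r b (c * h) c t₀ Y Z)
    (hL : IsLowerPair r b (c * h) c s₀ y z) (hst : s₀ ≤ t₀) (hy : ∀ t ≤ s₀, y t ≤ Y t)
    (hz : ∀ t ≤ s₀, z t ≤ Z t) :
    ∃ φ θ : ℝ → ℝ, IsPositiveMonotoneFront r b h c φ θ ∧
      ∀ t ≤ s₀, y t ≤ φ t ∧ φ t ≤ Y t ∧ z t ≤ 1 - θ t ∧ 1 - θ t ≤ Z t := by
  -- Then `a d ≥ (2 + b) ^ 2`, which exceeds both `2` and `b`.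
  set a := 2 + b with hadef
  set d := c + a with hddef
  have ha : 0 < a := by positivity
  have hd : 0 < d := by positivity
  have hM : 2 ≤ a * d := by nlinarith
  have hbM : b < a * d := by nlinarith
  have hcd : d - a = c := by rw [hddef]; ring
  have hk : 0 ≤ c * h := by positivity
  have hym := isBddSource_cutBelow hL.cont_fst hL.le_one_fst
  have hzm := isBddSource_cutBelow hL.cont_snd hL.le_one_snd
  have hyp := isBddSource_cutAbove hU.cont_fst hU.nonneg_fst
  have hzp := isBddSource_cutAbove hU.cont_snd hU.nonneg_snd
  have hcomp : ∀ {f g : ℝ → ℝ}, f s₀ ≤ 0 → (∀ t ≤ s₀, f t ≤ 1) → (∀ t ≤ s₀, f t ≤ g t) →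
      (∀ t ≤ t₀, 0 ≤ g t) → cutBelow s₀ f ≤ cutAbove t₀ g := by
    intro f g h0 h1 hfg hg t
    have hg' := hg _ (min_le_right t t₀)
    rcases le_total t s₀ with ht | ht
    · refine max_le (le_min zero_le_one hg') (le_min (h1 _ (min_le_right _ _)) ?_)
      rw [min_eq_left ht, min_eq_left (ht.trans hst)]
      exact hfg t ht
    · rw [cutBelow_eq_zero h0 ht]
      exact le_min zero_le_one hg'
  obtain ⟨φ, ζ, hφm, hζm, h1, h2, h3, h4, hφ, hζ⟩ := exists_monotone_fixedPoint (k := c * h) ha hd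
    hr0 hr1 hM hb hbM.le hym hzm hyp hzp (monotone_cutAbove hU.mono_fst)
    (monotone_cutAbove hU.mono_snd) (hcomp hL.nonpos_fst hL.le_one_fst hy hU.nonneg_fst)
    (hcomp hL.nonpos_snd hL.le_one_snd hz hU.nonneg_snd)
    (hU.green_sourceFst_le ha hd hcd hr0 hr1 hM hk) (hU.green_sourceSnd_le ha hd hcd hb hbM.le)
    (hL.le_green_sourceFst ha hd hcd hr0 hr1 hM hk) (hL.le_green_sourceSnd ha hd hcd hb hbM.le)
  have hφb : IsBddSource 1 φ :=
    ⟨hφm.measurable, fun t => ⟨(hym.2 t).1.trans (h1 t), (h2 t).trans (hyp.2 t).2⟩⟩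
  have hζb : IsBddSource 1 ζ :=
    ⟨hζm.measurable, fun t => ⟨(hzm.2 t).1.trans (h3 t), (h4 t).trans (hzp.2 t).2⟩⟩
  refine ⟨φ, fun t => 1 - ζ t, ?_, fun t ht => ?_⟩
  · rw [← hcd] at hφ ⊢
    refine isPositiveMonotoneFront_of_fixedPoint ha hd hr0 hr1 hM hb hbM hφb hζb hφm hζm
      ?_ ?_ ?_ hφ hζ
    · exact squeeze_zero (fun t => (hφb.2 t).1) h2 (tendsto_cutAbove hU.tendsto_fst)
    · exact squeeze_zero (fun t => (hζb.2 t).1) h4 (tendsto_cutAbove hU.tendsto_snd)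
    · filter_upwards [hL.pos_fst, eventually_le_atBot s₀] with t ht hts
      exact ht.trans_le ((le_cutBelow hts).trans (h1 t))
  · simp only [sub_sub_cancel]
    exact ⟨(le_cutBelow ht).trans (h1 t), (h2 t).trans (cutAbove_le (ht.trans hst)),
      (le_cutBelow ht).trans (h3 t), (h4 t).trans (cutAbove_le (ht.trans hst))⟩

/-! ### The number `ω_*` and the exponential continued by its tangent. -/

theorem HasDriftLaplacianOn.continuousOn {c t₀ : ℝ} {Y E : ℝ → ℝ}
    (hY : HasDriftLaplacianOn c t₀ Y E) : ContinuousOn Y (Iio t₀) := by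
  obtain ⟨Y', hY⟩ := hY
  exact fun t ht => (hY t ht).1.continuousAt.continuousWithinAt

theorem omegaStar_pos : 0 < omegaStar := omegaStar_isGreatest.1.1

/-- For `τ = ω_* / 2` this reads `exp (τ - 2) = 2 τ`. Together with positivity it is all that the
construction uses about `ω_*`. -/
theorem exp_omegaStar : Real.exp (omegaStar / 2 - 2) = omegaStar := by
  have h := omegaStar_isGreatest.1.2
  rw [show omegaStar / 2 - 2 = Real.log omegaStar by linarith, Real.exp_log omegaStar_pos]

/-- The exponential for negative arguments, continued by its tangent line at `0`. -/
noncomputable def expLin (x : ℝ) : ℝ := Real.exp (min x 0) + max x 0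

theorem expLin_of_nonpos {x : ℝ} (hx : x ≤ 0) : expLin x = Real.exp x := by
  simp [expLin, hx]

theorem expLin_of_nonneg {x : ℝ} (hx : 0 ≤ x) : expLin x = 1 + x := by
  simp [expLin, hx]

theorem expLin_pos (x : ℝ) : 0 < expLin x :=
  add_pos_of_pos_of_nonneg (Real.exp_pos _) (le_max_right _ _)

theorem expLin_le_exp (x : ℝ) : expLin x ≤ Real.exp x := by
  rcases le_total x 0 with hx | hx
  · rw [expLin_of_nonpos hx]
  · rw [expLin_of_nonneg hx]
    linarith [Real.add_one_le_exp x]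

theorem monotone_expLin : Monotone expLin := fun _ _ h =>
  add_le_add (Real.exp_le_exp.2 (min_le_min_right _ h)) (max_le_max_right _ h)

theorem continuous_expLin : Continuous expLin := by
  unfold expLin
  fun_prop

/-- `expLin` lies below `max (log B) 0 + exp x / B`. -/
theorem expLin_le_log_add {B : ℝ} (hB : 0 < B) (x : ℝ) :
    expLin x ≤ max (Real.log B) 0 + Real.exp x / B := by
  rcases le_total B 1 with h1 | h1
  · calc expLin x ≤ Real.exp x := expLin_le_exp x
      _ ≤ Real.exp x / B := le_div_self (Real.exp_pos x).le hB h1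
      _ ≤ _ := le_add_of_nonneg_left (le_max_right _ _)
  · refine le_trans ?_ (add_le_add_left (le_max_left (Real.log B) 0) _)
    rcases le_total x 0 with hx | hx
    · rw [expLin_of_nonpos hx]
      have h2 : 1 - 1 / B ≤ Real.log B := by
        simpa using Real.one_sub_inv_le_log_of_pos hB
      have h3 : 0 ≤ 1 - 1 / B := by
        rw [sub_nonneg, div_le_one hB]
        exact h1
      have h4 : Real.exp x ≤ 1 := Real.exp_le_one_iff.2 hx
      have h5 : Real.exp x * (1 - 1 / B) ≤ 1 * (1 - 1 / B) := mul_le_mul_of_nonneg_right h4 h3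
      have h6 : Real.exp x / B = Real.exp x * (1 / B) := by ring
      rw [h6]
      linarith
    · rw [expLin_of_nonneg hx]
      -- The graph of `exp x / B` lies above its tangent of slope `1`, which touches it at `x = log
      -- B`.
      have := Real.add_one_le_exp (x - Real.log B)
      rw [Real.exp_sub, Real.exp_log hB] at this
      linarith

theorem hasDerivAt_expLin (x : ℝ) : HasDerivAt expLin (Real.exp (min x 0)) x := by
  have hl : ∀ x ≤ 0, HasDerivWithinAt expLin (Real.exp x) (Iic 0) x := fun x hx =>
    (Real.hasDerivAt_exp x).hasDerivWithinAt.congr (fun y hy => expLin_of_nonpos hy)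
      (expLin_of_nonpos hx)
  have hr : ∀ x ≥ 0, HasDerivWithinAt expLin 1 (Ici 0) x := fun x hx =>
    ((hasDerivAt_id x).const_add 1).hasDerivWithinAt.congr (fun y hy => expLin_of_nonneg hy)
      (expLin_of_nonneg hx)
  rcases lt_trichotomy x 0 with hx | hx | hx
  · rw [min_eq_left hx.le]
    exact (hl x hx.le).hasDerivAt (Iic_mem_nhds hx)
  · subst hx
    have h := (hl 0 le_rfl).union (by simpa using hr 0 le_rfl)
    rw [Iic_union_Ici, hasDerivWithinAt_univ] at h
    simpa using h
  · rw [min_eq_right hx.le, Real.exp_zero]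
    exact (hr x hx.le).hasDerivAt (Ici_mem_nhds hx)

/-- The derivative has a corner at `0`; since only left derivatives count, the value at `0` belongs
to the exponential branch. -/
theorem hasDriftLaplacianOn_expLin (c t₀ : ℝ) (hc : 0 < c) :
    HasDriftLaplacianOn c t₀ (fun t => expLin (c / 2 * t))
      (fun t => if t ≤ 0 then -(c ^ 2 / 4) * Real.exp (c / 2 * t) else -(c ^ 2 / 2)) := by
  have hlin : ∀ t, HasDerivAt (fun t : ℝ => c / 2 * t) (c / 2) t := fun t =>
    ((hasDerivAt_id t).const_mul (c / 2)).congr_deriv (by simp)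
  refine ⟨fun t => Real.exp (min (c / 2 * t) 0) * (c / 2), fun t _ =>
    ⟨(hasDerivAt_expLin _).comp t (hlin t), ?_⟩⟩
  beta_reduce
  split_ifs with ht
  · have hneg : ∀ s ≤ t, c / 2 * s ≤ 0 := fun s hs =>
      mul_nonpos_of_nonneg_of_nonpos (by positivity) (hs.trans ht)
    rw [min_eq_left (hneg t le_rfl)]
    have h := (((hlin t).exp).mul_const (c / 2)).hasDerivWithinAt (s := Iic t)
    refine (h.congr (fun s hs => by rw [min_eq_left (hneg s hs)])
      (by rw [min_eq_left (hneg t le_rfl)])).congr_deriv (by ring)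
  · push Not at ht
    have hpos : ∀ s, 0 < s → min (c / 2 * s) 0 = 0 := fun s hs =>
      min_eq_right (by positivity)
    have h : HasDerivAt (fun s => Real.exp (min (c / 2 * s) 0) * (c / 2)) 0 t := by
      refine (hasDerivAt_const t (c / 2)).congr_of_eventuallyEq ?_
      filter_upwards [lt_mem_nhds ht] with s hs
      rw [hpos s hs, Real.exp_zero, one_mul]
    rw [hpos t ht]
    exact h.hasDerivWithinAt.congr_deriv (by simp; ring)

/-! ### Continuing slow pairs near `-∞` to full upper and lower pairs. -/

/-- A pair of supersolutions near `-∞`. -/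
structure IsSlowUpperPair (r b k c T : ℝ) (Y Z : ℝ → ℝ) : Prop where
  mono_fst : MonotoneOn Y (Iio T)
  mono_snd : MonotoneOn Z (Iio T)
  tendsto_fst : Tendsto Y atBot (𝓝 0)
  tendsto_snd : Tendsto Z atBot (𝓝 0)
  eqn_fst : ∃ E, HasDriftLaplacianOn c T Y E ∧
    ∀ t < T, E t + Y t * (1 - r - Y t + r * Z (t - k)) ≤ 0
  eqn_snd : ∃ E, HasDriftLaplacianOn c T Z E ∧ ∀ t < T, E t + b * Y t * (1 - Z t) ≤ 0

/-- A pair of subsolutions near `-∞` which decay slower than `exp (c t / 2)`. -/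
structure IsSlowLowerPair (r b k c T : ℝ) (Y Z : ℝ → ℝ) : Prop where
  nonneg_fst : ∀ t < T, 0 ≤ Y t
  tendsto_fst : Tendsto Y atBot (𝓝 0)
  tendsto_snd : Tendsto Z atBot (𝓝 0)
  slow : Tendsto (fun t => Y t / Real.exp (c / 2 * t)) atBot atTop
  eqn_fst : ∃ E, HasDriftLaplacianOn c T Y E ∧
    ∀ t < T, 0 ≤ E t + Y t * (1 - r - Y t + r * Z (t - k))
  eqn_snd : ∃ E, HasDriftLaplacianOn c T Z E ∧ ∀ t < T, 0 ≤ E t + b * Y t * (1 - Z t)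

theorem nonneg_of_monotoneOn_of_tendsto {T : ℝ} {Y : ℝ → ℝ} (hm : MonotoneOn Y (Iio T))
    (h : Tendsto Y atBot (𝓝 0)) : ∀ t < T, 0 ≤ Y t := fun t ht => by
  refine le_of_tendsto h ?_
  filter_upwards [eventually_le_atBot t] with s hs
  exact hm (hs.trans_lt ht) ht hs

theorem tendsto_exp_half_mul_atBot {c : ℝ} (hc : 0 < c) :
    Tendsto (fun t => Real.exp (c / 2 * t)) atBot (𝓝 0) :=
  Real.tendsto_exp_atBot.comp (tendsto_id.const_mul_atBot (by positivity))

/-- A slow local upper pair plus a fast global one is an upper pair. -/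
theorem IsSlowUpperPair.exists_isUpperPair {r b h c T κ : ℝ} {Y Z : ℝ → ℝ}
    (hS : IsSlowUpperPair r b (c * h) c T Y Z) (hr0 : 0 < r) (hb : 0 < b) (hh : 0 ≤ h)
    (hc : 0 < c) (hκ : 0 < κ)
    (hfast : ∀ x, r * (expLin (x - c ^ 2 * h / 2) / (omegaStar / 2)) ≤
      c ^ 2 / 4 - (1 - r) + c ^ 2 / 4 / (b * (omegaStar / 2)) * Real.exp x - κ) :
    ∃ t₀ < T, ∃ A ≥ 0, ∃ A' : ℝ, ∃ W : ℝ → ℝ, (∀ t, W t ≤ A' * Real.exp (c / 2 * t)) ∧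
      (∀ t, 0 ≤ W t) ∧
      IsUpperPair r b (c * h) c t₀ (fun t => Y t + A * Real.exp (c / 2 * t))
        (fun t => Z t + W t) := by
  set τ := omegaStar / 2 with hτdef
  have hτ : 0 < τ := half_pos omegaStar_pos
  set s := c ^ 2 / 4 with hsdef
  have hs : 0 < s := by positivity
  set δ := c ^ 2 * h / 2 with hδdef
  have hδ : 0 ≤ δ := by positivity
  -- With this amplitude `b y₂ = (s / τ) exp x` for `x = c (t + N) / 2`, so on the exponential
  -- branch the linear part of the second equation vanishes.
  set A₀ := s / (b * τ) with hA₀def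
  have hA₀ : 0 < A₀ := by positivity
  set β := b / s with hβdef
  have hβ : 0 < β := by positivity
  have hβA : β * A₀ = 1 / τ := by rw [hβdef, hA₀def]; field_simp
  -- Where `Y, Z < η`, the cross terms satisfy `r (Y z₂ + Z y₂) ≤ r (β η + η) y₂ = κ y₂`, which the
  -- margin `κ` pays for.
  set η := κ / (r * (1 + β)) with hηdef
  have hη : 0 < η := by positivity
  have hηκ : r * (η + β * η) = κ := by rw [hηdef]; field_simp
  obtain ⟨T₂, hT₂⟩ := eventually_atBot.1 ((hS.tendsto_fst.eventually (gt_mem_nhds hη)).and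
    (hS.tendsto_snd.eventually (gt_mem_nhds hη)))
  set t₀ := min T₂ (T - 1) with ht₀def
  have ht₀2 : t₀ ≤ T₂ := min_le_left _ _
  have ht₀T : t₀ < T := (min_le_right _ _).trans_lt (by linarith)
  -- The translation `N` gives the fast pair the argument `X` at `t₀`, where `A₀ exp X` and `(1 + X)
  -- / τ` are both at least `1`.
  set X := max τ (1 / A₀) with hXdef
  have hXpos : 0 < X := hτ.trans_le (le_max_left _ _)
  set N := 2 * X / c - t₀ with hNdef
  have hN : c / 2 * (t₀ + N) = X := by rw [hNdef]; field_simp; ring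
  set y₂ : ℝ → ℝ := fun t => A₀ * Real.exp (c / 2 * (t + N)) with hy₂
  set z₂ : ℝ → ℝ := fun t => τ⁻¹ * expLin (c / 2 * (t + N)) with hz₂
  have hy₂pos : ∀ t, 0 < y₂ t := fun t => mul_pos hA₀ (Real.exp_pos _)
  have hz₂pos : ∀ t, 0 < z₂ t := fun t => mul_pos (inv_pos.2 hτ) (expLin_pos _)
  have hz₂le : ∀ t, z₂ t ≤ β * y₂ t := fun t => by
    have : β * y₂ t = τ⁻¹ * Real.exp (c / 2 * (t + N)) := by
      rw [hy₂]
      simp only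
      rw [← mul_assoc, hβA, one_div]
    rw [this]
    exact mul_le_mul_of_nonneg_left (expLin_le_exp _) (inv_pos.2 hτ).le
  have hy₂eq : ∀ t, y₂ t = A₀ * Real.exp (c / 2 * N) * Real.exp (c / 2 * t) := fun t => by
    rw [hy₂]
    simp only
    rw [mul_assoc, ← Real.exp_add]
    ring_nf
  have hy₂mono : Monotone y₂ := fun u v huv => by
    rw [hy₂]
    simp only
    gcongr
  have hz₂mono : Monotone z₂ := fun u v huv =>
    mul_le_mul_of_nonneg_left (monotone_expLin (by gcongr)) (inv_pos.2 hτ).le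
  have hz₂mono' : ∀ t, z₂ (t - c * h) ≤ z₂ t := fun t =>
    hz₂mono (by have := mul_nonneg hc.le hh; linarith)
  have hy₂bot : Tendsto y₂ atBot (𝓝 0) := by
    rw [show y₂ = _ from funext hy₂eq]
    simpa using (tendsto_exp_half_mul_atBot hc).const_mul (A₀ * Real.exp (c / 2 * N))
  have hz₂bot : Tendsto z₂ atBot (𝓝 0) :=
    squeeze_zero (fun t => (hz₂pos t).le) hz₂le (by simpa using hy₂bot.const_mul β)
  have hy₂E : HasDriftLaplacianOn c t₀ y₂ (fun t => -s * y₂ t) := by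
    have := ((HasDriftLaplacianOn.exp c (t₀ + N) (c / 2)).comp_add_const N).const_mul A₀
    rw [add_sub_cancel_right] at this
    refine this.congr rfl fun t _ => ?_
    rw [hy₂, hsdef]
    ring
  have hz₂E := ((hasDriftLaplacianOn_expLin c (t₀ + N) hc).comp_add_const N).const_mul τ⁻¹
  rw [add_sub_cancel_right] at hz₂E
  have hz₂ineq : ∀ t, τ⁻¹ * (if t + N ≤ 0 then -(c ^ 2 / 4) * Real.exp (c / 2 * (t + N))
      else -(c ^ 2 / 2)) + b * y₂ t * (1 - z₂ t) ≤ 0 := fun t => by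
    have hby : b * y₂ t = s * τ⁻¹ * Real.exp (c / 2 * (t + N)) := by
      rw [hy₂, hA₀def]
      field_simp
    rw [hby]
    split_ifs with ht
    · have : 0 ≤ s * τ⁻¹ * Real.exp (c / 2 * (t + N)) * z₂ t := by
        have := (hz₂pos t).le
        positivity
      rw [← hsdef]
      linarith
    · push Not at ht
      set x := c / 2 * (t + N) with hx
      have hx0 : 0 ≤ x := by positivity
      -- The second inequality on the linear branch reduces to this bound, with equality at `x = τ -
      -- 2`: it is `1 + y ≤ exp y` at `y = τ - 2 - x`, combined with the equation for `ω_*`.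
      have h1 : Real.exp x * (τ - 1 - x) ≤ 2 * τ := by
        have h2 : τ - 1 - x ≤ Real.exp (τ - 2 - x) := by
          linarith [Real.add_one_le_exp (τ - 2 - x)]
        have h3 : Real.exp x * Real.exp (τ - 2 - x) = 2 * τ := by
          rw [← Real.exp_add, show x + (τ - 2 - x) = τ - 2 by ring, exp_omegaStar, hτdef]
          ring
        calc _ ≤ Real.exp x * Real.exp (τ - 2 - x) :=
              mul_le_mul_of_nonneg_left h2 (Real.exp_pos _).le
          _ = _ := h3
      have hz : z₂ t = τ⁻¹ * (1 + x) := by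
        rw [hz₂]
        simp only
        rw [← hx, expLin_of_nonneg hx0]
      have h4 : τ⁻¹ * -(c ^ 2 / 2) + s * τ⁻¹ * Real.exp x * (1 - z₂ t) =
          s * τ⁻¹ * τ⁻¹ * (Real.exp x * (τ - 1 - x) - 2 * τ) := by
        rw [hz, hsdef]
        field_simp
        ring
      rw [h4]
      exact mul_nonpos_of_nonneg_of_nonpos (by positivity) (by linarith)
  have hy₂ineq : ∀ t, -s * y₂ t + y₂ t * (1 - r - y₂ t + r * z₂ (t - c * h)) ≤ -κ * y₂ t :=
    fun t => by
    have h1 := hfast (c / 2 * (t + N))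
    have h2 : r * z₂ (t - c * h) ≤ s - (1 - r) + y₂ t - κ := by
      have e : c / 2 * (t - c * h + N) = c / 2 * (t + N) - δ := by rw [hδdef]; ring
      rw [hz₂]
      simp only
      rw [e, inv_mul_eq_div]
      exact h1
    have h3 := mul_le_mul_of_nonneg_left h2 (hy₂pos t).le
    linarith
  have hYnn := nonneg_of_monotoneOn_of_tendsto hS.mono_fst hS.tendsto_fst
  have hZnn := nonneg_of_monotoneOn_of_tendsto hS.mono_snd hS.tendsto_snd
  obtain ⟨E₁, hE₁, hE₁i⟩ := hS.eqn_fst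
  obtain ⟨E₂, hE₂, hE₂i⟩ := hS.eqn_snd
  have hsub : Iic t₀ ⊆ Iio T := fun t (ht : t ≤ t₀) => ht.trans_lt ht₀T
  have hch : 0 ≤ c * h := mul_nonneg hc.le hh
  refine ⟨t₀, ht₀T, A₀ * Real.exp (c / 2 * N), by positivity,
    β * (A₀ * Real.exp (c / 2 * N)), z₂,
    fun t => by rw [mul_assoc, ← hy₂eq]; exact hz₂le t, fun t => (hz₂pos t).le, ?_⟩
  simp only [← hy₂eq]
  have hy₂c : Continuous y₂ := by fun_prop
  have hz₂c : Continuous z₂ :=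
    (continuous_expLin.comp (by fun_prop : Continuous fun t => c / 2 * (t + N))).const_mul _
  refine ⟨(hE₁.continuousOn.mono hsub).add hy₂c.continuousOn,
    (hE₂.continuousOn.mono hsub).add hz₂c.continuousOn,
    (hS.mono_fst.mono hsub).add (hy₂mono.monotoneOn _),
    (hS.mono_snd.mono hsub).add (hz₂mono.monotoneOn _),
    fun t ht => add_nonneg (hYnn t (hsub ht)) (hy₂pos t).le,
    fun t ht => add_nonneg (hZnn t (hsub ht)) (hz₂pos t).le, ?_, ?_,
    by simpa using hS.tendsto_fst.add hy₂bot, by simpa using hS.tendsto_snd.add hz₂bot,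
    ⟨_, (hE₁.mono ht₀T.le).add hy₂E, fun t ht => ?_⟩,
    ⟨_, (hE₂.mono ht₀T.le).add hz₂E, fun t ht hlt => ?_⟩⟩
  · have h1 : 1 ≤ y₂ t₀ := by
      rw [hy₂]
      simp only
      rw [hN]
      have h2 : 1 / A₀ ≤ Real.exp X := by
        linarith [Real.add_one_le_exp X, le_max_right τ (1 / A₀)]
      rwa [div_le_iff₀' hA₀] at h2
    linarith [hYnn t₀ ht₀T]
  · have h1 : 1 ≤ z₂ t₀ := by
      rw [hz₂]
      simp only
      rw [hN, expLin_of_nonneg hXpos.le, inv_mul_eq_div, le_div_iff₀ hτ]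
      linarith [le_max_left τ (1 / A₀)]
    linarith [hZnn t₀ ht₀T]
  · have h1 := hE₁i t (ht.trans ht₀T)
    have h2 := hy₂ineq t
    have h3 := (hT₂ t (ht.le.trans ht₀2)).1
    have h4 := (hT₂ (t - c * h) (by linarith)).2
    have h5 := hYnn t (ht.trans ht₀T)
    have h6 := hZnn (t - c * h) (by linarith)
    have h7 := hy₂pos t
    have h8 : Y t * z₂ (t - c * h) ≤ η * (β * y₂ t) :=
      mul_le_mul h3.le ((hz₂mono' t).trans (hz₂le t)) (hz₂pos _).le hη.le
    have h9 : y₂ t * Z (t - c * h) ≤ y₂ t * η := mul_le_mul_of_nonneg_left h4.le h7.le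
    have h10 : r * (Y t * z₂ (t - c * h) + y₂ t * Z (t - c * h)) ≤ κ * y₂ t := by
      calc _ ≤ r * (η * (β * y₂ t) + y₂ t * η) :=
            mul_le_mul_of_nonneg_left (add_le_add h8 h9) hr0.le
        _ = r * (η + β * η) * y₂ t := by ring
        _ = _ := by rw [hηκ]
    have h11 : 0 ≤ Y t * y₂ t := mul_nonneg h5 h7.le
    linarith
  · have h1 := hE₂i t (ht.trans ht₀T)
    have h2 := hz₂ineq t
    -- In the second equation the cross terms have the favourable sign.
    have h3 : 0 ≤ b * (y₂ t * Z t + Y t * z₂ t) := by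
      have h5 := hYnn t (ht.trans ht₀T)
      have h6 := hZnn t (ht.trans ht₀T)
      have := (hy₂pos t).le
      have := (hz₂pos t).le
      positivity
    linarith

/-- Subtract `e` and `β e`, where `e = A exp (c t / 2)` and `β = 4 b / c ^ 2`. This vector solves
the linear part of the second equation. In the first equation `1 - r < c ^ 2 / 4` gives a gain `(c ^
2 / 4 - (1 - r)) e`, which absorbs the mixed terms once `Y` and `Z` are small. `A` is chosen to make
both components nonpositive at `t₀`, and slow decay keeps the first one positive near `-∞`. -/
theorem IsSlowLowerPair.exists_isLowerPair {r b h c T : ℝ} {Y Z : ℝ → ℝ}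
    (hS : IsSlowLowerPair r b (c * h) c T Y Z) (hr0 : 0 < r) (hb : 0 < b) (hh : 0 ≤ h)
    (hc : 0 < c) (hcr : 1 - r < c ^ 2 / 4) (t₁ : ℝ) :
    ∃ t₀ ≤ t₁, ∃ A ≥ 0, ∃ A' ≥ 0, IsLowerPair r b (c * h) c t₀
      (fun t => Y t - A * Real.exp (c / 2 * t)) (fun t => Z t - A' * Real.exp (c / 2 * t)) := by
  set s := c ^ 2 / 4 with hsdef
  have hs : 0 < s := by positivity
  set δ := c ^ 2 * h / 2 with hδdef
  set β := b / s with hβdef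
  have hβ : 0 < β := by positivity
  have hβs : β * s = b := by rw [hβdef]; field_simp
  set η := min 1 ((s - (1 - r)) / (r * (1 + β))) with hηdef
  have hη : 0 < η := lt_min one_pos (div_pos (by linarith) (by positivity))
  have hη1 : η ≤ 1 := min_le_left _ _
  have hηs : r * (η + β * η) ≤ s - (1 - r) := by
    have h1 : η ≤ (s - (1 - r)) / (r * (1 + β)) := min_le_right _ _
    rw [le_div_iff₀ (by positivity)] at h1
    linarith
  obtain ⟨T₂, hT₂⟩ := eventually_atBot.1 ((hS.tendsto_fst.eventually (gt_mem_nhds hη)).and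
    (hS.tendsto_snd.eventually (gt_mem_nhds hη)))
  set t₀ := min (min T₂ t₁) (T - 1) with ht₀def
  have ht₀2 : t₀ ≤ T₂ := (min_le_left _ _).trans (min_le_left _ _)
  have ht₀T : t₀ < T := (min_le_right _ _).trans_lt (by linarith)
  obtain ⟨E₁, hE₁, hE₁i⟩ := hS.eqn_fst
  obtain ⟨E₂, hE₂, hE₂i⟩ := hS.eqn_snd
  have hsub : Iic t₀ ⊆ Iio T := fun t (ht : t ≤ t₀) => ht.trans_lt ht₀T
  have hch : 0 ≤ c * h := mul_nonneg hc.le hh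
  set A := max (Y t₀) (Z t₀ / β) / Real.exp (c / 2 * t₀) with hAdef
  have hA : 0 ≤ A := div_nonneg (le_max_of_le_left (hS.nonneg_fst t₀ ht₀T)) (Real.exp_pos _).le
  set e : ℝ → ℝ := fun t => A * Real.exp (c / 2 * t) with hedef
  have he0 : ∀ t, 0 ≤ e t := fun t => mul_nonneg hA (Real.exp_pos _).le
  have het₀ : e t₀ = max (Y t₀) (Z t₀ / β) := by
    rw [hedef, hAdef]
    simp only
    rw [div_mul_cancel₀ _ (Real.exp_pos _).ne']
  have hed : ∀ t, e (t - c * h) ≤ e t := fun t => by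
    refine mul_le_mul_of_nonneg_left (Real.exp_le_exp.2 ?_) hA
    gcongr
    linarith
  have heE : HasDriftLaplacianOn c t₀ e (fun t => -s * e t) :=
    ((HasDriftLaplacianOn.exp c t₀ (c / 2)).const_mul A).congr rfl fun t _ => by
      rw [hedef, hsdef]
      ring
  have hebot : Tendsto e atBot (𝓝 0) := by
    simpa using (tendsto_exp_half_mul_atBot hc).const_mul A
  have hec : Continuous e := by fun_prop
  refine ⟨t₀, (min_le_left _ _).trans (min_le_right _ _), A, hA, β * A,
    by positivity, ?_⟩
  simp only [mul_assoc β]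
  change IsLowerPair r b (c * h) c t₀ (fun t => Y t - e t) (fun t => Z t - β * e t)
  refine ⟨(hE₁.continuousOn.mono hsub).sub hec.continuousOn,
    (hE₂.continuousOn.mono hsub).sub (hec.const_mul β).continuousOn, fun t ht => ?_,
    fun t ht => ?_, ?_, ?_, by simpa using hS.tendsto_fst.sub hebot,
    by simpa using hS.tendsto_snd.sub (hebot.const_mul β), ?_,
    ⟨_, (hE₁.mono ht₀T.le).sub heE, fun t ht hlt => ?_⟩,
    ⟨_, (hE₂.mono ht₀T.le).sub (heE.const_mul β), fun t ht hlt => ?_⟩⟩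
  · linarith [(hT₂ t (ht.trans ht₀2)).1, he0 t]
  · linarith [(hT₂ t (ht.trans ht₀2)).2, mul_nonneg hβ.le (he0 t)]
  · linarith [het₀, le_max_left (Y t₀) (Z t₀ / β)]
  · have h1 := le_max_right (Y t₀) (Z t₀ / β)
    rw [← het₀, div_le_iff₀' hβ] at h1
    linarith
  · filter_upwards [hS.slow.eventually_gt_atTop A] with t ht
    rw [lt_div_iff₀ (Real.exp_pos _)] at ht
    exact sub_pos.2 ht
  · have h1 := hE₁i t (ht.trans ht₀T)
    have h3 := (hT₂ t (ht.le.trans ht₀2)).1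
    have h4 := (hT₂ (t - c * h) (by linarith)).2
    have h5 := hS.nonneg_fst t (ht.trans ht₀T)
    have h6 := he0 t
    have h7 := he0 (t - c * h)
    have h8 := hed t
    have h9 : 0 ≤ e t * (s - (1 - r) - r * (η + β * η)) :=
      mul_nonneg h6 (by linarith)
    have h10 : 0 ≤ e t * (2 * Y t - e t) := mul_nonneg h6 (by linarith)
    have h11 : e t * Z (t - c * h) ≤ e t * η := mul_le_mul_of_nonneg_left h4.le h6
    have h12 : (Y t - e t) * (β * e (t - c * h)) ≤ η * (β * e t) :=
      mul_le_mul (by linarith) (mul_le_mul_of_nonneg_left h8 hβ.le) (by positivity) hη.le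
    have h13 := mul_le_mul_of_nonneg_left h11 hr0.le
    have h14 := mul_le_mul_of_nonneg_left h12 hr0.le
    linarith
  · have h1 := hE₂i t (ht.trans ht₀T)
    have h5 := hS.nonneg_fst t (ht.trans ht₀T)
    have h6 := he0 t
    have h7 : 0 ≤ b * e t * (Z t + β * Y t - β * e t) := by
      have : 0 ≤ β * Y t := by positivity
      exact mul_nonneg (by positivity) (by linarith)
    have h8 : β * s * e t = b * e t := by rw [hβs]
    linarith

/-- With `B = r (b / s) exp (-δ)` the exponential on the right is `r exp (x - δ) / (B τ)`, so
`expLin_le_log_add` leaves the margin `s - (1 - r) - r max (log B) 0 / τ`. If `log B > 0` it is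
positive by the hypothesis on `bzF`, which says `r log B < τ (s - (1 - r))`; otherwise by `1 - r <
s`. -/
theorem fast_upper_margin {r b h c : ℝ} (hr0 : 0 < r) (hb : 0 < b) (hc : 0 < c)
    (hcr : 1 - r < c ^ 2 / 4) (hf : 0 < bzF (c ^ 2) r b h) :
    ∃ κ > 0, ∀ x, r * (expLin (x - c ^ 2 * h / 2) / (omegaStar / 2)) ≤
      c ^ 2 / 4 - (1 - r) + c ^ 2 / 4 / (b * (omegaStar / 2)) * Real.exp x - κ := by
  set τ := omegaStar / 2 with hτdef
  have hτ : 0 < τ := half_pos omegaStar_pos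
  set s := c ^ 2 / 4 with hsdef
  have hs : 0 < s := by positivity
  set δ := c ^ 2 * h / 2 with hδdef
  set B := r * (b / s) * Real.exp (-δ) with hBdef
  have hB : 0 < B := by positivity
  have hlogB : Real.log B = -Real.log (c ^ 2 / (4 * b * r)) - δ := by
    rw [hBdef, Real.log_mul (by positivity) (Real.exp_pos _).ne', Real.log_exp,
      show r * (b / s) = (c ^ 2 / (4 * b * r))⁻¹ by rw [hsdef]; field_simp, Real.log_inv]
    ring
  have hlt : r * Real.log B < τ * (s - (1 - r)) := by
    have h1 : bzF (c ^ 2) r b h = τ * (s - (1 - r)) / r - Real.log B := by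
      rw [bzF, hlogB, hsdef, hτdef, hδdef]
      field_simp
      ring
    rw [h1, sub_pos, lt_div_iff₀ hr0] at hf
    linarith
  refine ⟨s - (1 - r) - r * (max (Real.log B) 0 / τ), ?_, fun x => ?_⟩
  · rw [gt_iff_lt, sub_pos, mul_div_assoc', div_lt_iff₀ hτ]
    rcases max_cases (Real.log B) 0 with ⟨h1, _⟩ | ⟨h1, _⟩
    · rw [h1]
      linarith
    · rw [h1, mul_zero]
      exact mul_pos (by linarith) hτ
  · have h1 := expLin_le_log_add hB (x - δ)
    have h2 : r * (Real.exp (x - δ) / B / τ) = s / (b * τ) * Real.exp x := by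
      rw [hBdef, sub_eq_add_neg, Real.exp_add]
      field_simp
    have h3 : r * (expLin (x - δ) / τ) ≤
        r * ((max (Real.log B) 0 + Real.exp (x - δ) / B) / τ) := by gcongr
    rw [add_div, mul_add, h2] at h3
    linarith

/-- In the noncritical case, slow local pairs give a front with the same asymptotics, up to
multiples of `exp (c t / 2)`. -/
theorem exists_front_of_slow_pairs {r b h c T : ℝ} {Y Z y z : ℝ → ℝ} (hr0 : 0 < r) (hr1 : r ≤ 1)
    (hb : 0 < b) (hh : 0 ≤ h) (hc : 0 < c) (hcr : 1 - r < c ^ 2 / 4)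
    (hf : 0 < bzF (c ^ 2) r b h) (hU : IsSlowUpperPair r b (c * h) c T Y Z)
    (hL : IsSlowLowerPair r b (c * h) c T y z) (hy : ∀ t < T, y t ≤ Y t)
    (hz : ∀ t < T, z t ≤ Z t) :
    ∃ φ θ : ℝ → ℝ, IsPositiveMonotoneFront r b h c φ θ ∧ ∃ A : ℝ, ∀ᶠ t in atBot,
      y t - A * Real.exp (c / 2 * t) ≤ φ t ∧ φ t ≤ Y t + A * Real.exp (c / 2 * t) ∧
      z t - A * Real.exp (c / 2 * t) ≤ 1 - θ t ∧ 1 - θ t ≤ Z t + A * Real.exp (c / 2 * t) := by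
  obtain ⟨κ, hκ, hfast⟩ := fast_upper_margin hr0 hb hc hcr hf
  obtain ⟨t₀, ht₀, A₁, hA₁, A₂, W, hW, hW0, hup⟩ :=
    hU.exists_isUpperPair hr0 hb hh hc hκ hfast
  obtain ⟨s₀, hs₀, A₃, hA₃, A₄, hA₄, hlow⟩ := hL.exists_isLowerPair hr0 hb hh hc hcr t₀
  obtain ⟨φ, θ, hfront, hbd⟩ := exists_front_of_pairs hr0 hr1 hb hh hc hup hlow hs₀
    (fun t ht => by
      have := hy t (by linarith)
      have := Real.exp_pos (c / 2 * t)
      have := mul_nonneg hA₁ this.le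
      have := mul_nonneg hA₃ (Real.exp_pos (c / 2 * t)).le
      linarith)
    (fun t ht => by
      have := hz t (by linarith)
      have := hW0 t
      have := mul_nonneg hA₄ (Real.exp_pos (c / 2 * t)).le
      linarith)
  refine ⟨φ, θ, hfront, max (max A₁ A₂) (max A₃ A₄), ?_⟩
  filter_upwards [eventually_le_atBot s₀] with t ht
  obtain ⟨h1, h2, h3, h4⟩ := hbd t ht
  have he := (Real.exp_pos (c / 2 * t)).le
  have hle : ∀ {u}, u ≤ max (max A₁ A₂) (max A₃ A₄) → u * Real.exp (c / 2 * t) ≤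
      max (max A₁ A₂) (max A₃ A₄) * Real.exp (c / 2 * t) := fun hu =>
    mul_le_mul_of_nonneg_right hu he
  have e1 := hle ((le_max_left A₁ A₂).trans (le_max_left _ (max A₃ A₄)))
  have e2 := hle ((le_max_right A₁ A₂).trans (le_max_left _ (max A₃ A₄)))
  have e3 := hle ((le_max_left A₃ A₄).trans (le_max_right (max A₁ A₂) _))
  have e4 := hle ((le_max_right A₃ A₄).trans (le_max_right (max A₁ A₂) _))
  have e5 := hW t
  refine ⟨?_, ?_, ?_, ?_⟩ <;> linarith

/-! ### The critical speed `c = 2 √(1 - r)` with `r < 1`. -/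

theorem tendsto_exp_mul_atBot {μ : ℝ} (hμ : 0 < μ) :
    Tendsto (fun t => Real.exp (μ * t)) atBot (𝓝 0) :=
  Real.tendsto_exp_atBot.comp (tendsto_id.const_mul_atBot hμ)

theorem tendsto_neg_pow_mul_exp_atBot (n : ℕ) {μ : ℝ} (hμ : 0 < μ) :
    Tendsto (fun t => (-t) ^ n * Real.exp (μ * t)) atBot (𝓝 0) := by
  have h1 : Tendsto (fun t : ℝ => μ * -t) atBot atTop :=
    tendsto_neg_atBot_atTop.const_mul_atTop hμ
  have h2 := ((Real.tendsto_pow_mul_exp_neg_atTop_nhds_zero n).comp h1).const_mul ((μ ^ n)⁻¹)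
  rw [mul_zero] at h2
  refine h2.congr fun t => ?_
  simp only [Function.comp]
  rw [mul_pow, show -(μ * -t) = μ * t by ring]
  field_simp

/-- `μ = c / 2` is the critical point of `μ ^ 2 - c μ`, so differentiating `exp (μ t)` in `μ` there
gives another eigenfunction for the same eigenvalue. -/
theorem HasDriftLaplacianOn.neg_mul_exp (c t₀ : ℝ) :
    HasDriftLaplacianOn c t₀ (fun t => -t * Real.exp (c / 2 * t))
      (fun t => -(c ^ 2 / 4) * (-t * Real.exp (c / 2 * t))) := by
  have he : ∀ t, HasDerivAt (fun t => Real.exp (c / 2 * t)) (Real.exp (c / 2 * t) * (c / 2)) t :=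
    fun t => (((hasDerivAt_id t).const_mul (c / 2)).exp).congr_deriv (by simp)
  refine ⟨fun t => (-1 - c / 2 * t) * Real.exp (c / 2 * t), fun t _ => ⟨?_, ?_⟩⟩
  · exact ((hasDerivAt_neg t).mul (he t)).congr_deriv (by ring)
  · have h1 : HasDerivAt (fun t => -1 - c / 2 * t) (-(c / 2)) t :=
      (((hasDerivAt_id t).const_mul (c / 2)).const_sub (-1)).congr_deriv (by simp)
    exact (h1.mul (he t)).hasDerivWithinAt.congr_deriv (by ring)

theorem monotoneOn_neg_mul_exp {c : ℝ} (hc : 0 < c) :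
    MonotoneOn (fun t => -t * Real.exp (c / 2 * t)) (Iic (-(2 / c))) := by
  have he : ∀ t, HasDerivAt (fun t => -t * Real.exp (c / 2 * t))
      ((-1 - c / 2 * t) * Real.exp (c / 2 * t)) t := fun t =>
    ((hasDerivAt_neg t).mul (((hasDerivAt_id t).const_mul (c / 2)).exp)).congr_deriv
      (by simp; ring)
  refine monotoneOn_of_deriv_nonneg (convex_Iic _) (by fun_prop) (by fun_prop) fun t ht => ?_
  rw [interior_Iic] at ht
  rw [(he t).deriv]
  refine mul_nonneg ?_ (Real.exp_pos _).le
  have h1 : c / 2 * t ≤ c / 2 * -(2 / c) := mul_le_mul_of_nonneg_left (le_of_lt ht) (by positivity)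
  have h2 : c / 2 * -(2 / c) = -1 := by field_simp
  linarith

/-- Existence of a front for `c = 2 √(1 - r)`, `r < 1`. -/
theorem exists_front_critical {r b h c : ℝ} (hr0 : 0 < r) (hr1 : r < 1) (hb : 0 < b)
    (hh : 0 ≤ h) (hc : 0 < c) (hcr : c ^ 2 / 4 = 1 - r) (hf : 0 < bzF (c ^ 2) r b h) :
    ∃ φ θ : ℝ → ℝ, IsPositiveMonotoneFront r b h c φ θ := by
  set s := c ^ 2 / 4 with hsdef
  have hs : 0 < s := by positivity
  set β := b / s with hβdef
  have hβ : 0 < β := by positivity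
  have hβs : β * s = b := by rw [hβdef]; field_simp
  set k := c * h with hkdef
  have hk : 0 ≤ k := mul_nonneg hc.le hh
  -- `B` is the limit of `r β f(t - k) / f(t)` at `-∞`. Since `c ^ 2 = 4 (1 - r)`, the `ω_*` terms
  -- of `bzF` cancel and the hypothesis becomes `log B < 0`.
  set B := r * β * Real.exp (-(c / 2 * k)) with hBdef
  have hB : 0 < B := by positivity
  have hB1 : B < 1 := by
    have hlogB : Real.log B = -bzF (c ^ 2) r b h := by
      rw [hBdef, Real.log_mul (by positivity) (Real.exp_pos _).ne', Real.log_exp, bzF,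
        show r * β = (c ^ 2 / (4 * b * r))⁻¹ by rw [hβdef, hsdef]; field_simp, Real.log_inv,
        show (1 - r) = c ^ 2 / 4 from hcr.symm, hkdef]
      field_simp
      ring
    rw [← Real.log_neg_iff hB, hlogB]
    linarith
  set f : ℝ → ℝ := fun t => -t * Real.exp (c / 2 * t) with hfdef
  have hfc : Continuous f := by fun_prop
  have hfE : ∀ t₀, HasDriftLaplacianOn c t₀ f (fun t => -s * f t) := fun t₀ =>
    HasDriftLaplacianOn.neg_mul_exp c t₀
  have hfbot : Tendsto f atBot (𝓝 0) := by
    simpa [hfdef] using tendsto_neg_pow_mul_exp_atBot 1 (half_pos hc)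
  -- The first bound makes `f` monotone; the second gives `B (-t + k) ≤ -t`.
  set t₀ := min (-(2 / c)) (-(B * k / (1 - B))) with ht₀def
  have h2c : 0 < 2 / c := by positivity
  have ht₀c : t₀ ≤ -(2 / c) := min_le_left _ _
  have hfpos : ∀ t < 0, 0 < f t := fun t ht => mul_pos (by linarith) (Real.exp_pos _)
  have ht₀neg : t₀ < 0 := by linarith
  have hft₀ := hfpos t₀ ht₀neg
  have hfd : ∀ t ≤ t₀, r * (β * f (t - k)) ≤ f t := fun t ht => by
    have h1 : r * (β * f (t - k)) = B * (-t + k) * Real.exp (c / 2 * t) := by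
      rw [hfdef, hBdef]
      simp only
      rw [show c / 2 * (t - k) = c / 2 * t + -(c / 2 * k) by ring, Real.exp_add]
      ring
    rw [h1]
    refine mul_le_mul_of_nonneg_right ?_ (Real.exp_pos _).le
    have h2 : B * k / (1 - B) ≤ -t := by linarith [min_le_right (-(2 / c)) (-(B * k / (1 - B)))]
    rw [div_le_iff₀ (by linarith)] at h2
    linarith
  -- Any positive multiple of `(f, β f)` is a supersolution, because the linear parts vanish and the
  -- quadratic ones have the right sign; `a` lifts both components to `1` at `t₀`.
  set a := max 1 (max 1 (1 / β) / f t₀) with hadef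
  have ha1 : 1 ≤ a := le_max_left _ _
  have ha : 0 < a := by linarith
  have hat₀ : max 1 (1 / β) ≤ a * f t₀ := (div_le_iff₀ hft₀).1 (le_max_right _ _)
  have hU : IsUpperPair r b k c t₀ (fun t => a * f t) (fun t => a * β * f t) := by
    have hm := (monotoneOn_neg_mul_exp hc).mono (Iic_subset_Iic.2 ht₀c)
    have hfnn : ∀ t ≤ t₀, 0 ≤ f t := fun t ht => (hfpos t (by linarith)).le
    refine ⟨(hfc.const_mul _).continuousOn, (hfc.const_mul _).continuousOn,
      fun u hu v hv huv => mul_le_mul_of_nonneg_left (hm hu hv huv) ha.le,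
      fun u hu v hv huv => mul_le_mul_of_nonneg_left (hm hu hv huv) (by positivity),
      fun t ht => mul_nonneg ha.le (hfnn t ht), fun t ht => mul_nonneg (by positivity) (hfnn t ht),
      (le_max_left _ _).trans hat₀, ?_, by simpa using hfbot.const_mul a,
      by simpa using hfbot.const_mul (a * β),
      ⟨_, (hfE t₀).const_mul _, fun t ht => ?_⟩, ⟨_, (hfE t₀).const_mul _, fun t ht _ => ?_⟩⟩
    · have := (le_max_right 1 (1 / β)).trans hat₀
      rw [div_le_iff₀ hβ] at this
      linarith
    · have h1 := hfd t ht.le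
      have h2 := hfnn t ht.le
      have h3 : 0 ≤ a * f t * a * (f t - r * (β * f (t - k))) :=
        mul_nonneg (by positivity) (by linarith)
      rw [← hcr]
      linarith
    · have h2 := hfnn t ht.le
      have h3 : 0 ≤ b * (a * f t) * (a * β * f t) := by positivity
      have h4 : β * s * (a * f t) = b * (a * f t) := by rw [hβs]
      linarith
  have hsmall : ∀ᶠ t in atBot, (-t) ^ 2 * Real.exp (c / 4 * t) < s / 4 ∧ f t < 1 :=
    ((tendsto_neg_pow_mul_exp_atBot 2 (by positivity)).eventually
      (gt_mem_nhds (by positivity))).and (hfbot.eventually (gt_mem_nhds one_pos))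
  obtain ⟨T, hT⟩ := eventually_atBot.1 hsmall
  set s₀ := min T t₀ with hs₀def
  have hs₀T : s₀ ≤ T := min_le_left _ _
  have hs₀t : s₀ ≤ t₀ := min_le_right _ _
  -- The lower pair is `(f - K e + q, 0)`. The linear residual `(s / 4) q` compensates the quadratic
  -- loss, since `f ^ 2 = t ^ 2 exp (c t / 4) q`. `K` makes the first component nonpositive at `s₀`.
  set K := 1 - s₀ with hKdef
  set e : ℝ → ℝ := fun t => Real.exp (c / 2 * t) with hedef
  set q : ℝ → ℝ := fun t => Real.exp (3 * c / 4 * t) with hqdef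
  have hqe : ∀ t, q t = Real.exp (c / 4 * t) * e t := fun t => by
    rw [hqdef, hedef]
    simp only
    rw [← Real.exp_add]
    ring_nf
  have hyeq : ∀ t, f t - K * e t + q t = e t * (-t - K + Real.exp (c / 4 * t)) := fun t => by
    rw [hqe]
    simp only [hfdef, hedef]
    ring
  have hle1 : ∀ t ≤ s₀, Real.exp (c / 4 * t) ≤ 1 := fun t ht =>
    Real.exp_le_one_iff.2 (mul_nonpos_of_nonneg_of_nonpos (by positivity) (by linarith))
  have hylef : ∀ t ≤ s₀, f t - K * e t + q t ≤ f t := fun t ht => by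
    rw [hyeq]
    simp only [hfdef]
    rw [mul_comm]
    refine mul_le_mul_of_nonneg_right ?_ (Real.exp_pos _).le
    linarith [hle1 t ht]
  have hyE := ((hfE s₀).sub ((HasDriftLaplacianOn.exp c s₀ (c / 2)).const_mul K)).add
    (HasDriftLaplacianOn.exp c s₀ (3 * c / 4))
  have hL : IsLowerPair r b k c s₀ (fun t => f t - K * e t + q t) (fun _ => 0) := by
    refine ⟨by fun_prop, continuousOn_const, fun t ht => ?_, fun _ _ => zero_le_one, ?_, le_rfl,
      ?_, tendsto_const_nhds, ?_, ⟨_, hyE, fun t ht hpos => ?_⟩,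
      ⟨fun _ => 0, ⟨fun _ => 0, fun t _ => ⟨hasDerivAt_const t 0, ?_⟩⟩,
        fun t _ h0 => absurd h0 (lt_irrefl 0)⟩⟩
    · exact (hylef t ht).trans (hT t (by linarith)).2.le
    · rw [hyeq]
      exact mul_nonpos_of_nonneg_of_nonpos (Real.exp_pos _).le (by linarith [hle1 s₀ le_rfl])
    · simpa using (hfbot.sub ((tendsto_exp_mul_atBot (half_pos hc)).const_mul K)).add
        (tendsto_exp_mul_atBot (by positivity : 0 < 3 * c / 4))
    · filter_upwards [eventually_lt_atBot (-K)] with t ht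
      rw [hyeq]
      exact mul_pos (Real.exp_pos _) (by linarith [Real.exp_pos (c / 4 * t)])
    · have h1 : (f t - K * e t + q t) ^ 2 ≤ f t ^ 2 :=
        pow_le_pow_left₀ hpos.le (hylef t ht.le) 2
      have h2 : f t ^ 2 ≤ s / 4 * q t := by
        have h3 := (hT t (by linarith)).1.le
        have h4 : f t ^ 2 = (-t) ^ 2 * Real.exp (c / 4 * t) * q t := by
          rw [hqe]
          simp only [hfdef, hedef]
          rw [mul_pow, ← Real.exp_nat_mul, mul_assoc, ← mul_assoc (Real.exp (c / 4 * t)),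
            ← Real.exp_add, ← Real.exp_add]
          ring_nf
        rw [h4]
        exact mul_le_mul_of_nonneg_right h3 (Real.exp_pos _).le
      have h5 : (c / 2) ^ 2 - c * (c / 2) = -s := by rw [hsdef]; ring
      have h6 : (3 * c / 4) ^ 2 - c * (3 * c / 4) = -(3 / 4 * s) := by rw [hsdef]; ring
      rw [h5, h6, ← hcr]
      change 0 ≤ -s * f t - K * (-s * e t) + -(3 / 4 * s) * q t + _
      linarith
    · simpa using hasDerivWithinAt_const t (Iic t) (0 : ℝ)
  obtain ⟨φ, θ, hfront, -⟩ := exists_front_of_pairs hr0 hr1.le hb hh hc hU hL hs₀t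
    (fun t ht => by
      have h1 := hylef t ht
      have h2 := (hfpos t (by linarith)).le
      have h3 : 1 * f t ≤ a * f t := mul_le_mul_of_nonneg_right ha1 h2
      linarith)
    (fun t ht => mul_nonneg (by positivity) (hfpos t (by linarith)).le)
  exact ⟨φ, θ, hfront⟩

/-! ### Noncritical speeds with `r < 1`: exponential asymptotics. -/

/-- Existence of a front with exponential asymptotics. -/
theorem exists_front_exponential {r b h c : ℝ} (hr0 : 0 < r) (hr1 : r < 1) (hb : 0 < b)
    (hh : 0 ≤ h) (hc : 0 < c) (hcr : 1 - r < c ^ 2 / 4) (hf : 0 < bzF (c ^ 2) r b h) :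
    ∃ φ θ : ℝ → ℝ, IsPositiveMonotoneFront r b h c φ θ ∧
      HasExponentialAsymptotics r b h c φ θ := by
  set D := Real.sqrt (c ^ 2 - 4 * (1 - r)) with hDdef
  have hDsq : D ^ 2 = c ^ 2 - 4 * (1 - r) := Real.sq_sqrt (by linarith)
  have hD : 0 < D := Real.sqrt_pos.2 (by linarith)
  have hDc : D < c := by
    refine lt_of_pow_lt_pow_left₀ 2 hc.le ?_
    linarith
  set l := slowRate r c with hldef
  have hl : l = (c - D) / 2 := rfl
  have hl0 : 0 < l := by rw [hl]; linarith
  have hlc : l < c / 2 := by rw [hl]; linarith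
  -- `ε < l` makes `P ^ 2` negligible against `Q`. `ε ≤ D / 2` gives `l + ε ≤ c / 2`, so corrections
  -- of order `exp (c t / 2)` are `O(Q)`; it also puts `l + ε` strictly between the characteristic
  -- roots, whence `κ > 0`.
  set ε := min (l / 2) (D / 2) with hεdef
  have hε : 0 < ε := lt_min (by linarith) (by linarith)
  have hεl : ε < l := by linarith [min_le_left (l / 2) (D / 2)]
  have hεD : ε ≤ D / 2 := min_le_right _ _
  have hμc : l + ε ≤ c / 2 := by rw [hl]; linarith
  set κ := ε * (D - ε) with hκdef
  have hκ : 0 < κ := mul_pos hε (by linarith)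
  set β := b / (1 - r) with hβdef
  have hβ : 0 < β := div_pos hb (by linarith)
  have hβr : β * (1 - r) = b := div_mul_cancel₀ _ (by linarith)
  have hχl : l ^ 2 - c * l = -(1 - r) := by rw [hl]; linear_combination (1 / 4) * hDsq
  have hχμ : (l + ε) ^ 2 - c * (l + ε) = -(1 - r) - κ := by
    rw [hl, hκdef]; linear_combination (1 / 4) * hDsq
  set P : ℝ → ℝ := fun t => Real.exp (l * t) with hPdef
  set Q : ℝ → ℝ := fun t => Real.exp ((l + ε) * t) with hQdef
  have hP0 : ∀ t, 0 < P t := fun t => Real.exp_pos _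
  have hQ0 : ∀ t, 0 < Q t := fun t => Real.exp_pos _
  have hPm : Monotone P := fun u v huv => Real.exp_le_exp.2 (by gcongr)
  have hQm : Monotone Q := fun u v huv => Real.exp_le_exp.2 (by gcongr)
  have hPbot : Tendsto P atBot (𝓝 0) := tendsto_exp_mul_atBot hl0
  have hQbot : Tendsto Q atBot (𝓝 0) := tendsto_exp_mul_atBot (by linarith)
  have hQP : ∀ t ≤ 0, Q t ≤ P t := fun t ht => Real.exp_le_exp.2 (by
    have := mul_nonpos_of_nonneg_of_nonpos hε.le ht
    linarith)
  have hk : 0 ≤ c * h := mul_nonneg hc.le hh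
  -- In the denominator, `4 r β` serves the first upper inequality, `1` the first lower one and `b`
  -- the second lower one.
  set η := κ / (4 * r * β + b + 1) with hηdef
  have hη : 0 < η := by positivity
  have hηκ : (4 * r * β + b + 1) * η = κ := by rw [hηdef]; field_simp
  obtain ⟨T₁, hT₁⟩ := eventually_atBot.1 ((tendsto_exp_mul_atBot (μ := l - ε)
    (by linarith)).eventually (gt_mem_nhds hη))
  set T := min T₁ 0 with hTdef
  have hT0 : T ≤ 0 := min_le_right _ _
  have hPQ : ∀ t < T, P t ^ 2 ≤ η * Q t := fun t ht => by
    have h1 := (hT₁ t (ht.le.trans (min_le_left _ _))).le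
    have h2 : P t ^ 2 = Real.exp ((l - ε) * t) * Q t := by
      simp only [hPdef, hQdef]
      rw [← Real.exp_add, ← Real.exp_nat_mul]
      ring_nf
    rw [h2]
    exact mul_le_mul_of_nonneg_right h1 (hQ0 t).le
  have hE : ∀ ς : ℝ, HasDriftLaplacianOn c T (fun t => P t + ς * Q t)
      (fun t => -(1 - r) * (P t + ς * Q t) - ς * κ * Q t) := fun ς =>
    ((HasDriftLaplacianOn.exp c T l).add
      ((HasDriftLaplacianOn.exp c T (l + ε)).const_mul ς)).congr rfl fun t _ => by
        rw [hχl, hχμ]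
        simp only [hPdef, hQdef]
        ring
  have hU : IsSlowUpperPair r b (c * h) c T (fun t => P t + 1 * Q t)
      (fun t => β * (P t + 1 * Q t)) := by
    have hm : Monotone fun t => P t + 1 * Q t := by
      simpa using hPm.add hQm
    have hbot : Tendsto (fun t => P t + 1 * Q t) atBot (𝓝 0) := by
      simpa using hPbot.add hQbot
    refine ⟨hm.monotoneOn _, (hm.const_mul hβ.le).monotoneOn _, hbot,
      by simpa using hbot.const_mul β, ⟨_, hE 1, fun t ht => ?_⟩,
      ⟨_, (hE 1).const_mul β, fun t ht => ?_⟩⟩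
    · have h1 : P (t - c * h) + 1 * Q (t - c * h) ≤ P t + 1 * Q t := hm (by linarith)
      have hY0 : 0 < P t + 1 * Q t := by linarith [hP0 t, hQ0 t]
      have h2 : (P t + 1 * Q t) ^ 2 ≤ 4 * (η * Q t) := by
        have h3 : P t + 1 * Q t ≤ 2 * P t := by linarith [hQP t (by linarith)]
        have h4 := pow_le_pow_left₀ hY0.le h3 2
        linarith [hPQ t ht]
      have h5 : r * β * ((P t + 1 * Q t) * (P (t - c * h) + 1 * Q (t - c * h))) ≤
          r * β * (4 * (η * Q t)) := by
        refine mul_le_mul_of_nonneg_left (le_trans ?_ h2) (by positivity)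
        rw [sq]
        exact mul_le_mul_of_nonneg_left h1 hY0.le
      have h6 : (4 * r * β + b + 1) * η * Q t = κ * Q t := by rw [hηκ]
      have h7 : 0 ≤ (b + 1) * (η * Q t) := by have := (hQ0 t).le; positivity
      have h8 := sq_nonneg (P t + 1 * Q t)
      linarith
    · have hY0 : 0 < P t + 1 * Q t := by linarith [hP0 t, hQ0 t]
      have h1 : 0 ≤ β * (1 * κ * Q t) := by have := (hQ0 t).le; positivity
      have h2 : 0 ≤ b * β * (P t + 1 * Q t) ^ 2 := by positivity
      have h3 : β * (1 - r) * (P t + 1 * Q t) = b * (P t + 1 * Q t) := by rw [hβr]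
      linarith
  have hL : IsSlowLowerPair r b (c * h) c T (fun t => P t + (-1) * Q t)
      (fun t => β * (P t + (-1) * Q t)) := by
    have hbot : Tendsto (fun t => P t + (-1) * Q t) atBot (𝓝 0) := by
      simpa using hPbot.add (hQbot.const_mul (-1))
    have hnn : ∀ t < T, 0 ≤ P t + (-1) * Q t := fun t ht => by linarith [hQP t (by linarith)]
    have hsq : ∀ t < T, (P t + (-1) * Q t) ^ 2 ≤ η * Q t := fun t ht =>
      (pow_le_pow_left₀ (hnn t ht) (by linarith [hQ0 t]) 2).trans (hPQ t ht)
    refine ⟨hnn, hbot, by simpa using hbot.const_mul β, ?_, ⟨_, hE (-1), fun t ht => ?_⟩,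
      ⟨_, (hE (-1)).const_mul β, fun t ht => ?_⟩⟩
    · have h1 : Tendsto (fun t => Real.exp ((l - c / 2) * t)) atBot atTop :=
        Real.tendsto_exp_atTop.comp (tendsto_id.const_mul_atBot_of_neg (by linarith))
      have h2 : Tendsto (fun t => 1 - Real.exp (ε * t)) atBot (𝓝 (1 - 0)) :=
        (tendsto_exp_mul_atBot hε).const_sub 1
      refine (h1.atTop_mul_pos (by norm_num : (0 : ℝ) < 1 - 0) h2).congr fun t => ?_
      rw [eq_div_iff (Real.exp_pos _).ne']
      simp only [hPdef, hQdef]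
      rw [mul_sub, sub_mul, ← Real.exp_add, mul_one, ← Real.exp_add, ← Real.exp_add]
      ring_nf
    · have h1 := hsq t ht
      have h2 := hnn t ht
      have h3 := hnn (t - c * h) (by linarith)
      have h4 : 0 ≤ r * ((P t + (-1) * Q t) * (β * (P (t - c * h) + (-1) * Q (t - c * h)))) := by
        positivity
      have h6 : (4 * r * β + b + 1) * η * Q t = κ * Q t := by rw [hηκ]
      have h7 : 0 ≤ (4 * r * β + b) * (η * Q t) := by have := (hQ0 t).le; positivity
      linarith
    · have h1 := mul_le_mul_of_nonneg_left (hsq t ht) (by positivity : 0 ≤ b * β)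
      have h3 : β * (1 - r) * (P t + (-1) * Q t) = b * (P t + (-1) * Q t) := by rw [hβr]
      have h6 : β * ((4 * r * β + b + 1) * η * Q t) = β * (κ * Q t) := by rw [hηκ]
      have h7 : 0 ≤ β * ((4 * r * β + 1) * (η * Q t)) := by have := (hQ0 t).le; positivity
      linarith
  have hle : ∀ t, P t + (-1) * Q t ≤ P t + 1 * Q t := fun t => by linarith [hQ0 t]
  obtain ⟨φ, θ, hfront, A, hA⟩ := exists_front_of_slow_pairs hr0 hr1.le hb hh hc hcr hf hU hL
    (fun t _ => hle t) (fun t _ => mul_le_mul_of_nonneg_left (hle t) hβ.le)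
  have hAe : ∀ t ≤ 0, |A * Real.exp (c / 2 * t)| ≤ |A| * Q t := fun t ht => by
    rw [abs_mul, abs_of_pos (Real.exp_pos _)]
    refine mul_le_mul_of_nonneg_left (Real.exp_le_exp.2 ?_) (abs_nonneg A)
    exact mul_le_mul_of_nonpos_right hμc ht
  refine ⟨φ, θ, hfront, ε, hε, ?_, ?_⟩
  · refine IsBigO.of_bound (1 + |A|) ?_
    filter_upwards [hA, eventually_le_atBot 0] with t ht ht0
    have h1 := abs_le.1 (hAe t ht0)
    rw [Real.norm_eq_abs, Real.norm_eq_abs, abs_of_pos (Real.exp_pos ((l + ε) * t))]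
    change |φ t - P t| ≤ (1 + |A|) * Q t
    rw [abs_le]
    constructor <;> linarith [ht.1, ht.2.1]
  · refine IsBigO.of_bound (β + |A|) ?_
    filter_upwards [(tendsto_sub_const_atBot (c * h)).eventually
      (hA.and (eventually_le_atBot 0))] with t ⟨ht, ht0⟩
    have h1 := abs_le.1 (hAe _ ht0)
    have h2 : Q (t - c * h) ≤ Q t := hQm (by linarith)
    have h3 : (β + |A|) * Q (t - c * h) ≤ (β + |A|) * Q t :=
      mul_le_mul_of_nonneg_left h2 (by positivity)
    rw [Real.norm_eq_abs, Real.norm_eq_abs, abs_of_pos (Real.exp_pos ((l + ε) * t)),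
      mul_div_right_comm]
    change |θ (t - c * h) - (1 - β * P (t - c * h))| ≤ (β + |A|) * Q t
    rw [abs_le]
    constructor <;> linarith [ht.2.2.1, ht.2.2.2]

/-! ### The case `r = 1`: expansions in powers of `(-t) ^ (-1/2)` with logarithms. -/

/-- `(-t) ^ (-1 / 2)`. -/
noncomputable def recipSqrt (t : ℝ) : ℝ := (Real.sqrt (-t))⁻¹

section recipSqrt

theorem recipSqrt_pos {t : ℝ} (ht : t < 0) : 0 < recipSqrt t :=
  inv_pos.2 (Real.sqrt_pos.2 (by linarith))

theorem recipSqrt_sq {t : ℝ} (ht : t < 0) : recipSqrt t ^ 2 = (-t)⁻¹ := by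
  rw [recipSqrt, inv_pow, Real.sq_sqrt (by linarith)]

theorem hasDerivAt_recipSqrt {t : ℝ} (ht : t < 0) :
    HasDerivAt recipSqrt (recipSqrt t ^ 3 / 2) t := by
  have hs : 0 < Real.sqrt (-t) := Real.sqrt_pos.2 (by linarith)
  refine (((hasDerivAt_neg t).sqrt (by linarith)).inv hs.ne').congr_deriv ?_
  rw [recipSqrt]
  field_simp

theorem hasDerivAt_log_neg {t : ℝ} (ht : t < 0) :
    HasDerivAt (fun t => Real.log (-t)) (-recipSqrt t ^ 2) t := by
  refine ((hasDerivAt_neg t).log (by linarith)).congr_deriv ?_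
  rw [recipSqrt_sq ht]
  field_simp

theorem tendsto_sqrt_neg : Tendsto (fun t : ℝ => Real.sqrt (-t)) atBot atTop :=
  Real.tendsto_sqrt_atTop.comp tendsto_neg_atBot_atTop

theorem tendsto_recipSqrt : Tendsto recipSqrt atBot (𝓝 0) :=
  tendsto_inv_atTop_zero.comp tendsto_sqrt_neg

theorem tendsto_log_pow_mul_recipSqrt (n : ℕ) :
    Tendsto (fun t => Real.log (-t) ^ n * recipSqrt t) atBot (𝓝 0) := by
  have h := ((Real.isLittleO_pow_log_id_atTop (n := n)).tendsto_div_nhds_zero.comp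
    tendsto_sqrt_neg).const_mul ((2 : ℝ) ^ n)
  rw [mul_zero] at h
  refine h.congr' ?_
  filter_upwards [eventually_lt_atBot 0] with t ht
  simp only [Function.comp, id]
  rw [Real.log_sqrt (by linarith), recipSqrt, div_pow]
  field_simp

end recipSqrt

section expansions

variable (A B C G H c ς : ℝ)

/-- The expansion of `φ` at `-∞` in the critical case. -/
noncomputable def critFst (t : ℝ) : ℝ :=
  A * recipSqrt t ^ 4 + (B * Real.log (-t) + C) * recipSqrt t ^ 6 + ς * recipSqrt t ^ 7

/-- The expansion of `1 - θ` at `-∞` in the critical case. -/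
noncomputable def critSnd (t : ℝ) : ℝ :=
  2 * c * recipSqrt t ^ 2 + G * Real.log (-t) * recipSqrt t ^ 4 + ς * H * recipSqrt t ^ 5

/-- The derivative of `critFst`. -/
noncomputable def critFstDeriv (t : ℝ) : ℝ :=
  2 * A * recipSqrt t ^ 6 + (3 * (B * Real.log (-t) + C) - B) * recipSqrt t ^ 8
    + 7 / 2 * ς * recipSqrt t ^ 9

/-- The derivative of `critSnd`. -/
noncomputable def critSndDeriv (t : ℝ) : ℝ :=
  2 * c * recipSqrt t ^ 4 + (2 * G * Real.log (-t) - G) * recipSqrt t ^ 6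
    + 5 / 2 * ς * H * recipSqrt t ^ 7

/-- The second derivative of `critFst`. -/
noncomputable def critFstDeriv₂ (t : ℝ) : ℝ :=
  6 * A * recipSqrt t ^ 8 + (12 * (B * Real.log (-t) + C) - 7 * B) * recipSqrt t ^ 10
    + 63 / 4 * ς * recipSqrt t ^ 11

/-- The second derivative of `critSnd`. -/
noncomputable def critSndDeriv₂ (t : ℝ) : ℝ :=
  4 * c * recipSqrt t ^ 6 + (6 * G * Real.log (-t) - 5 * G) * recipSqrt t ^ 8
    + 35 / 4 * ς * H * recipSqrt t ^ 9

variable {A B C G H c ς}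

theorem hasDerivAt_critFst {t : ℝ} (ht : t < 0) :
    HasDerivAt (critFst A B C ς) (critFstDeriv A B C ς t) t := by
  have hR := hasDerivAt_recipSqrt ht
  have hl := hasDerivAt_log_neg ht
  refine ((((hR.fun_pow 4).const_mul A).add (((hl.const_mul B).add_const C).mul
    (hR.fun_pow 6))).add ((hR.fun_pow 7).const_mul ς)).congr_deriv ?_
  rw [critFstDeriv]
  push_cast
  ring

theorem hasDerivAt_critSnd {t : ℝ} (ht : t < 0) :
    HasDerivAt (critSnd G H c ς) (critSndDeriv G H c ς t) t := by
  have hR := hasDerivAt_recipSqrt ht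
  have hl := hasDerivAt_log_neg ht
  refine ((((hR.fun_pow 2).const_mul (2 * c)).add ((hl.const_mul G).mul
    (hR.fun_pow 4))).add ((hR.fun_pow 5).const_mul (ς * H))).congr_deriv ?_
  rw [critSndDeriv]
  push_cast
  ring

theorem hasDerivAt_critFstDeriv {t : ℝ} (ht : t < 0) :
    HasDerivAt (critFstDeriv A B C ς) (critFstDeriv₂ A B C ς t) t := by
  have hR := hasDerivAt_recipSqrt ht
  have hl := hasDerivAt_log_neg ht
  refine ((((hR.fun_pow 6).const_mul (2 * A)).add
    (((((hl.const_mul B).add_const C).const_mul 3).sub_const B).mul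
    (hR.fun_pow 8))).add ((hR.fun_pow 9).const_mul (7 / 2 * ς))).congr_deriv ?_
  rw [critFstDeriv₂]
  push_cast
  ring

theorem hasDerivAt_critSndDeriv {t : ℝ} (ht : t < 0) :
    HasDerivAt (critSndDeriv G H c ς) (critSndDeriv₂ G H c ς t) t := by
  have hR := hasDerivAt_recipSqrt ht
  have hl := hasDerivAt_log_neg ht
  refine ((((hR.fun_pow 4).const_mul (2 * c)).add (((hl.const_mul (2 * G)).sub_const G).mul
    (hR.fun_pow 6))).add ((hR.fun_pow 7).const_mul (5 / 2 * ς * H))).congr_deriv ?_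
  rw [critSndDeriv₂]
  push_cast
  ring

/-- Polynomials without constant term in the small quantities `(-t) ^ (-1 / 2)`,
`ln (-t) (-t) ^ (-1 / 2)`, `ln (-t) ^ 2 (-t) ^ (-1 / 2)` and a further one tend to zero. -/
theorem tendsto_comp_small {ρ : ℝ → ℝ} (hρ : Tendsto ρ atBot (𝓝 0)) {p : ℝ → ℝ → ℝ → ℝ → ℝ}
    (hp : Continuous fun q : ℝ × ℝ × ℝ × ℝ => p q.1 q.2.1 q.2.2.1 q.2.2.2) :
    Tendsto (fun t => p (recipSqrt t) (Real.log (-t) * recipSqrt t)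
      (Real.log (-t) ^ 2 * recipSqrt t) (ρ t)) atBot (𝓝 (p 0 0 0 0)) := by
  have h1 : Tendsto (fun t => Real.log (-t) * recipSqrt t) atBot (𝓝 0) := by
    simpa using tendsto_log_pow_mul_recipSqrt 1
  exact (hp.tendsto (0, 0, 0, 0)).comp (tendsto_recipSqrt.prodMk_nhds
    (h1.prodMk_nhds ((tendsto_log_pow_mul_recipSqrt 2).prodMk_nhds hρ)))

/-- The remainder of the expansion of the delayed value of `critSnd`. -/
noncomputable def critDelayRem (G H c ς k t : ℝ) : ℝ :=
  (critSnd G H c ς (t - k) - (2 * c * (recipSqrt t ^ 2 - k * recipSqrt t ^ 4)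
    + G * Real.log (-t) * recipSqrt t ^ 4 + ς * H * recipSqrt t ^ 5)) / recipSqrt t ^ 5

/-- With `R = recipSqrt t` one has `-(t - k) = -t (1 + k R ^ 2)`, so the delay only brings in powers
of `(1 + k R ^ 2)⁻¹` and a term `log (1 + k R ^ 2) = O(R ^ 2)`. -/
theorem tendsto_critDelayRem {k : ℝ} (hk : 0 ≤ k) :
    Tendsto (critDelayRem G H c ς k) atBot (𝓝 0) := by
  set a : ℝ → ℝ := fun t => (1 + k * recipSqrt t ^ 2)⁻¹ with ha
  have hden : Tendsto (fun t => 1 + k * recipSqrt t ^ 2) atBot (𝓝 1) := by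
    simpa using ((tendsto_recipSqrt.pow 2).const_mul k).const_add 1
  have hat : Tendsto a atBot (𝓝 1) := by
    simpa using hden.inv₀ one_ne_zero
  have hsa : Tendsto (fun t => Real.sqrt (a t)) atBot (𝓝 1) := by
    simpa using hat.sqrt
  have hlog : Tendsto (fun t => Real.log (1 + k * recipSqrt t ^ 2) / recipSqrt t) atBot
      (𝓝 0) := by
    refine squeeze_zero' ?_ ?_ (by simpa using tendsto_recipSqrt.const_mul k)
    · filter_upwards [eventually_lt_atBot 0] with t ht
      exact div_nonneg (Real.log_nonneg (by
        have := mul_nonneg hk (sq_nonneg (recipSqrt t))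
        linarith)) (recipSqrt_pos ht).le
    · filter_upwards [eventually_lt_atBot 0] with t ht
      have hR := recipSqrt_pos ht
      rw [div_le_iff₀ hR]
      have h1 : 0 < 1 + k * recipSqrt t ^ 2 := by positivity
      have := Real.log_le_sub_one_of_pos h1
      linarith
  have h1 : Tendsto (fun t => Real.log (-t) * recipSqrt t) atBot (𝓝 0) := by
    simpa using tendsto_log_pow_mul_recipSqrt 1
  have hlim : Tendsto (fun t => 2 * c * (k ^ 2 * (a t * recipSqrt t))
      + G * (Real.log (1 + k * recipSqrt t ^ 2) / recipSqrt t * a t ^ 2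
        - Real.log (-t) * recipSqrt t * (k * a t * (a t + 1)))
      + ς * H * (Real.sqrt (a t) * a t ^ 2 - 1)) atBot
      (𝓝 (2 * c * (k ^ 2 * (1 * 0)) + G * (0 * 1 ^ 2 - 0 * (k * 1 * (1 + 1)))
      + ς * H * (1 * 1 ^ 2 - 1))) :=
    ((((hat.mul tendsto_recipSqrt).const_mul _).const_mul _).add
      (((hlog.mul (hat.pow 2)).sub (h1.mul ((hat.const_mul k).mul
        (hat.add_const 1)))).const_mul G)).add (((hsa.mul (hat.pow 2)).sub_const 1).const_mul _)
  simp only [mul_zero, zero_mul, one_pow, mul_one, sub_self, add_zero] at hlim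
  refine hlim.congr' ?_
  filter_upwards [eventually_lt_atBot 0] with t ht
  have hR := recipSqrt_pos ht
  have hden0 : 0 < 1 + k * recipSqrt t ^ 2 := by positivity
  have hfac : -(t - k) = -t * (1 + k * recipSqrt t ^ 2) := by
    have := ht.ne
    rw [recipSqrt_sq ht]
    field_simp
    ring
  have hRd : recipSqrt (t - k) = recipSqrt t * Real.sqrt (a t) := by
    rw [recipSqrt, hfac, Real.sqrt_mul (by linarith), mul_inv, ha]
    simp only
    rw [Real.sqrt_inv, recipSqrt]
  have hld : Real.log (-(t - k)) = Real.log (-t) + Real.log (1 + k * recipSqrt t ^ 2) := by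
    rw [hfac, Real.log_mul (by linarith) hden0.ne']
  have ha0 : 0 ≤ a t := (inv_pos.2 hden0).le
  have hsq : Real.sqrt (a t) ^ 2 = a t := Real.sq_sqrt ha0
  have haR : a t * (1 + k * recipSqrt t ^ 2) = 1 := inv_mul_cancel₀ hden0.ne'
  rw [critDelayRem, critSnd, hRd, hld]
  set R := recipSqrt t
  set S := Real.sqrt (a t)
  set L := Real.log (1 + k * R ^ 2)
  rw [eq_div_iff (by positivity), ← hsq]
  rw [← hsq] at haR
  have hL : L / R * R ^ 5 = L * R ^ 4 := by field_simp
  linear_combination (G * S ^ 4) * hL + 2 * c * R ^ 2 * (k * R ^ 2 - 1) * haR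
    - G * Real.log (-t) * R ^ 4 * (S ^ 2 + 1) * haR

variable {b k : ℝ}

/-- As `(R ^ n)' = (n / 2) R ^ (n + 2)`, the orders can be read off: `hA`, `hB`, `hC` cancel `R ^
4`, `R ^ 6 ln (-t)`, `R ^ 6`, and the perturbation leaves `ς (b - 5 c H / 2) = -ς b / 4` at order `R
^ 7`. One spare power of `R` beats the logarithms in the rest. -/
theorem critSnd_residual (hA : b * A = 2 * c ^ 2) (hB : b * B = 2 * c * G)
    (hC : b * C = 4 * c ^ 3 - 4 * c - c * G) (hH : 2 * c * H = b) :
    ∃ ε : ℝ → ℝ, Tendsto ε atBot (𝓝 0) ∧ ∀ t < 0,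
      critSndDeriv₂ G H c ς t - c * critSndDeriv G H c ς t
        + b * critFst A B C ς t * (1 - critSnd G H c ς t) =
      recipSqrt t ^ 7 * (-(ς * b / 4) + ε t) := by
  set p : ℝ → ℝ → ℝ → ℝ → ℝ := fun R m _ _ => R * (-5 * G + 35 / 4 * ς * H * R) + 6 * G * m
    - b * ((B * m + C * R + ς * R ^ 2) * (2 * c + G * m * R + ς * H * R ^ 3)
      + A * (G * m + ς * H * R ^ 2)) with hp
  refine ⟨fun t => p (recipSqrt t) (Real.log (-t) * recipSqrt t)
    (Real.log (-t) ^ 2 * recipSqrt t) 0, ?_, fun t ht => ?_⟩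
  · have := tendsto_comp_small (tendsto_const_nhds (x := (0 : ℝ))) (p := p)
      (by simp only [hp]; fun_prop)
    rwa [show p 0 0 0 0 = 0 by simp [hp]] at this
  · simp only [hp, critSndDeriv₂, critSndDeriv, critFst, critSnd]
    set R := recipSqrt t
    set l := Real.log (-t)
    linear_combination R ^ 4 * hA + l * R ^ 6 * hB + R ^ 6 * (hC - 2 * c * hA)
      - 5 / 4 * ς * R ^ 7 * hH

/-- The terms in `R ^ 6` cancel through the leading coefficient `2 c` of `critSnd`; `hBA` and `hY`
cancel `R ^ 8 ln (-t)` and `R ^ 8`. The perturbation leaves `ς (A H + 2 c - 7 c / 2) = -ς c / 2` at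
order `R ^ 9`. -/
theorem critFst_residual (hk : 0 ≤ k) (hBA : A * G = c * B) (hAH : A * H = c)
    (hY : 6 * A + c * B - c * C - 2 * c * k * A - A ^ 2 = 0) :
    ∃ ε : ℝ → ℝ, Tendsto ε atBot (𝓝 0) ∧ ∀ t < 0,
      critFstDeriv₂ A B C ς t - c * critFstDeriv A B C ς t
        + critFst A B C ς t * (critSnd G H c ς (t - k) - critFst A B C ς t) =
      recipSqrt t ^ 9 * (-(ς * c / 2) + ε t) := by
  set p : ℝ → ℝ → ℝ → ℝ → ℝ := fun R m n ρ => R * (-7 * B + 12 * C) + 12 * B * m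
    + ς * (63 / 4) * R ^ 2 + A * ρ + (B * m + C * R + ς * R ^ 2) * (ς * H * R - 2 * c * k + R * ρ
      - 2 * A - R * (B * m + C * R + ς * R ^ 2)) + G * (B * n + C * m + ς * R * m) with hp
  refine ⟨fun t => p (recipSqrt t) (Real.log (-t) * recipSqrt t)
    (Real.log (-t) ^ 2 * recipSqrt t) (critDelayRem G H c ς k t), ?_,
    fun t ht => ?_⟩
  · have := tendsto_comp_small (tendsto_critDelayRem (G := G) (H := H) (c := c) (ς := ς) hk)
      (p := p) (by simp only [hp]; fun_prop)
    rwa [show p 0 0 0 0 = 0 by simp [hp]] at this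
  · have hR := recipSqrt_pos ht
    have hd : critSnd G H c ς (t - k) = 2 * c * (recipSqrt t ^ 2 - k * recipSqrt t ^ 4)
        + G * Real.log (-t) * recipSqrt t ^ 4 + ς * H * recipSqrt t ^ 5
        + recipSqrt t ^ 5 * critDelayRem G H c ς k t := by
      rw [critDelayRem]
      field_simp
      ring
    rw [hd]
    simp only [hp, critFstDeriv₂, critFstDeriv, critFst]
    set R := recipSqrt t
    set l := Real.log (-t)
    set ρ := critDelayRem G H c ς k t
    linear_combination R ^ 8 * hY + R ^ 8 * l * hBA + ς * R ^ 9 * hAH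

theorem tendsto_critFst_div :
    Tendsto (fun t => critFst A B C ς t / recipSqrt t ^ 4) atBot (𝓝 A) := by
  have h := tendsto_comp_small (tendsto_const_nhds (x := (0 : ℝ)))
    (p := fun R m _ _ => A + B * m * R + C * R ^ 2 + ς * R ^ 3) (by fun_prop)
  simp only [mul_zero, add_zero, ne_eq, OfNat.ofNat_ne_zero, not_false_eq_true, zero_pow] at h
  refine h.congr' ?_
  filter_upwards [eventually_lt_atBot 0] with t ht
  have hR := recipSqrt_pos ht
  rw [critFst, eq_div_iff (by positivity)]
  ring

theorem tendsto_critFst : Tendsto (critFst A B C ς) atBot (𝓝 0) := by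
  have h := (tendsto_critFst_div (A := A) (B := B) (C := C) (ς := ς)).mul (tendsto_recipSqrt.pow 4)
  simp only [ne_eq, OfNat.ofNat_ne_zero, not_false_eq_true, zero_pow, mul_zero] at h
  refine h.congr' ?_
  filter_upwards [eventually_lt_atBot 0] with t ht
  have hR := recipSqrt_pos ht
  field_simp

theorem tendsto_critSnd : Tendsto (critSnd G H c ς) atBot (𝓝 0) := by
  have h := tendsto_comp_small (tendsto_const_nhds (x := (0 : ℝ)))
    (p := fun R m _ _ => 2 * c * R ^ 2 + G * m * R ^ 3 + ς * H * R ^ 5) (by fun_prop)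
  simp only [mul_zero, add_zero, ne_eq, OfNat.ofNat_ne_zero, not_false_eq_true, zero_pow] at h
  refine h.congr fun t => ?_
  rw [critSnd]
  ring

theorem eventually_critFstDeriv_nonneg (hA : 0 < A) :
    ∀ᶠ t in atBot, 0 ≤ critFstDeriv A B C ς t := by
  have h := tendsto_comp_small (tendsto_const_nhds (x := (0 : ℝ)))
    (p := fun R m _ _ => 2 * A + 3 * B * m * R + (3 * C - B) * R ^ 2 + 7 / 2 * ς * R ^ 3)
    (by fun_prop)
  simp only [mul_zero, add_zero, ne_eq, OfNat.ofNat_ne_zero, not_false_eq_true,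
    zero_pow] at h
  filter_upwards [h.eventually (lt_mem_nhds (by linarith : 0 < 2 * A)), eventually_lt_atBot 0]
    with t ht ht0
  have hR := recipSqrt_pos ht0
  have : critFstDeriv A B C ς t = recipSqrt t ^ 6 * (2 * A
      + 3 * B * (Real.log (-t) * recipSqrt t) * recipSqrt t + (3 * C - B) * recipSqrt t ^ 2
      + 7 / 2 * ς * recipSqrt t ^ 3) := by
    rw [critFstDeriv]
    ring
  rw [this]
  exact mul_nonneg (by positivity) ht.le

theorem eventually_critSndDeriv_nonneg (hc : 0 < c) :
    ∀ᶠ t in atBot, 0 ≤ critSndDeriv G H c ς t := by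
  have h := tendsto_comp_small (tendsto_const_nhds (x := (0 : ℝ)))
    (p := fun R m _ _ => 2 * c + 2 * G * m * R - G * R ^ 2 + 5 / 2 * ς * H * R ^ 3)
    (by fun_prop)
  simp only [mul_zero, add_zero, sub_zero, ne_eq, OfNat.ofNat_ne_zero, not_false_eq_true,
    zero_pow] at h
  filter_upwards [h.eventually (lt_mem_nhds (by linarith : 0 < 2 * c)), eventually_lt_atBot 0]
    with t ht ht0
  have hR := recipSqrt_pos ht0
  have : critSndDeriv G H c ς t = recipSqrt t ^ 4 * (2 * c
      + 2 * G * (Real.log (-t) * recipSqrt t) * recipSqrt t - G * recipSqrt t ^ 2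
      + 5 / 2 * ς * H * recipSqrt t ^ 3) := by
    rw [critSndDeriv]
    ring
  rw [this]
  exact mul_nonneg (by positivity) ht.le

theorem tendsto_critFst_div_exp (hA : 0 < A) (hc : 0 < c) :
    Tendsto (fun t => critFst A B C ς t / Real.exp (c / 2 * t)) atBot atTop := by
  have h1 : Tendsto (fun t => ((-t) ^ 2 * Real.exp (c / 2 * t))⁻¹) atBot atTop := by
    refine Tendsto.inv_tendsto_nhdsGT_zero (tendsto_nhdsWithin_iff.2
      ⟨tendsto_neg_pow_mul_exp_atBot 2 (half_pos hc), ?_⟩)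
    filter_upwards [eventually_lt_atBot 0] with t ht
    have : 0 < -t := by linarith
    exact mem_Ioi.2 (by positivity)
  refine (h1.atTop_mul_pos hA (tendsto_critFst_div (A := A) (B := B) (C := C) (ς := ς))).congr' ?_
  filter_upwards [eventually_lt_atBot 0] with t ht
  have hR := recipSqrt_pos ht
  have h2 : (-t) ^ 2 = (recipSqrt t ^ 4)⁻¹ := by
    rw [show recipSqrt t ^ 4 = (recipSqrt t ^ 2) ^ 2 by ring, recipSqrt_sq ht, inv_pow, inv_inv]
  rw [h2, mul_inv, inv_inv]
  field_simp

end expansions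

theorem monotoneOn_of_hasDerivAt_nonneg {T : ℝ} {f f' : ℝ → ℝ}
    (h : ∀ t < T, HasDerivAt f (f' t) t) (h' : ∀ t < T, 0 ≤ f' t) : MonotoneOn f (Iio T) := by
  refine monotoneOn_of_deriv_nonneg (convex_Iio T)
    (fun t ht => (h t ht).continuousAt.continuousWithinAt) ?_ ?_
  · rw [interior_Iio]
    exact fun t ht => (h t ht).differentiableAt.differentiableWithinAt
  · rw [interior_Iio]
    intro t ht
    rw [(h t ht).deriv]
    exact h' t ht

/-- Existence of a front with algebraic asymptotics for `r = 1`. -/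
theorem exists_front_algebraic {b h c : ℝ} (hb : 0 < b) (hh : 0 ≤ h) (hc : 0 < c)
    (hf : 0 < bzF (c ^ 2) 1 b h) :
    ∃ φ θ : ℝ → ℝ, IsPositiveMonotoneFront 1 b h c φ θ ∧ HasCriticalAsymptotics b h c φ θ := by
  -- The second equation expresses `A`, `B`, `C` through `G`, and the `R ^ 8` balance `hY` of the
  -- first one then determines `G`.
  set G := 4 / 3 * (c ^ 2 * (1 + h + 1 / b) - 4) with hGdef
  set A := 2 * c ^ 2 / b with hAdef
  set B := 2 * c * G / b with hBdef
  set C := (4 * c ^ 3 - 4 * c - c * G) / b with hCdef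
  -- For any `H` strictly between `2 b / (5 c)` and `3 b / (4 c)` both leading residuals have the
  -- sign opposite to `ς`, so `ς = 1` gives an upper and `ς = -1` a lower pair.
  set H := b / (2 * c) with hHdef
  have hA0 : 0 < A := by positivity
  have hH0 : 0 < H := by positivity
  have hA : b * A = 2 * c ^ 2 := by rw [hAdef]; field_simp
  have hB : b * B = 2 * c * G := by rw [hBdef]; field_simp
  have hC : b * C = 4 * c ^ 3 - 4 * c - c * G := by rw [hCdef]; field_simp
  have hH : 2 * c * H = b := by rw [hHdef]; field_simp
  have hAH : A * H = c := by rw [hAdef, hHdef]; field_simp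
  have hBA : A * G = c * B := by rw [hAdef, hBdef]; field_simp
  have hY : 6 * A + c * B - c * C - 2 * c * (c * h) * A - A ^ 2 = 0 := by
    rw [hAdef, hBdef, hCdef, hGdef]
    field_simp
    ring
  have hk : 0 ≤ c * h := mul_nonneg hc.le hh
  obtain ⟨e₁, he₁, hE₁⟩ := critFst_residual (C := C) (ς := 1) hk hBA hAH hY
  obtain ⟨e₂, he₂, hE₂⟩ := critFst_residual (C := C) (ς := -1) hk hBA hAH hY
  obtain ⟨e₃, he₃, hE₃⟩ := critSnd_residual (ς := 1) hA hB hC hH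
  obtain ⟨e₄, he₄, hE₄⟩ := critSnd_residual (ς := -1) hA hB hC hH
  obtain ⟨T₁, hT₁⟩ := eventually_atBot.1
    ((((he₁.eventually (gt_mem_nhds (by positivity : 0 < c / 2))).and
      (he₂.eventually (lt_mem_nhds (by linarith : -(c / 2) < 0)))).and
      ((he₃.eventually (gt_mem_nhds (by positivity : 0 < b / 4))).and
      (he₄.eventually (lt_mem_nhds (by linarith : -(b / 4) < 0))))).and
      (((eventually_critFstDeriv_nonneg (B := B) (C := C) (ς := 1) hA0).and
      (eventually_critSndDeriv_nonneg (G := G) (H := H) (ς := 1) hc)).and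
      ((tendsto_critFst_div (A := A) (B := B) (C := C) (ς := -1)).eventually
      (lt_mem_nhds hA0))))
  set T := min T₁ 0 with hTdef
  have hTneg : ∀ t < T, t < 0 := fun t ht => ht.trans_le (min_le_right _ _)
  have hTle : ∀ t < T, t ≤ T₁ := fun t ht => ht.le.trans (min_le_left _ _)
  have hDf : ∀ ς, HasDriftLaplacianOn c T (critFst A B C ς)
      (fun t => critFstDeriv₂ A B C ς t - c * critFstDeriv A B C ς t) := fun ς =>
    .of_hasDerivAt (fun t ht => hasDerivAt_critFst (hTneg t ht))
      (fun t ht => hasDerivAt_critFstDeriv (hTneg t ht))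
  have hDs : ∀ ς, HasDriftLaplacianOn c T (critSnd G H c ς)
      (fun t => critSndDeriv₂ G H c ς t - c * critSndDeriv G H c ς t) := fun ς =>
    .of_hasDerivAt (fun t ht => hasDerivAt_critSnd (hTneg t ht))
      (fun t ht => hasDerivAt_critSndDeriv (hTneg t ht))
  have hU : IsSlowUpperPair 1 b (c * h) c T (critFst A B C 1) (critSnd G H c 1) := by
    refine ⟨monotoneOn_of_hasDerivAt_nonneg (fun t ht => hasDerivAt_critFst (hTneg t ht))
      (fun t ht => (hT₁ t (hTle t ht)).2.1.1), monotoneOn_of_hasDerivAt_nonneg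
      (fun t ht => hasDerivAt_critSnd (hTneg t ht)) (fun t ht => (hT₁ t (hTle t ht)).2.1.2),
      tendsto_critFst, tendsto_critSnd, ⟨_, hDf 1, fun t ht => ?_⟩, ⟨_, hDs 1, fun t ht => ?_⟩⟩
    · have h1 := hE₁ t (hTneg t ht)
      have h2 : recipSqrt t ^ 9 * (-(1 * c / 2) + e₁ t) ≤ 0 :=
        mul_nonpos_of_nonneg_of_nonpos (pow_nonneg (recipSqrt_pos (hTneg t ht)).le _)
          (by linarith [(hT₁ t (hTle t ht)).1.1.1])
      linarith
    · rw [hE₃ t (hTneg t ht)]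
      exact mul_nonpos_of_nonneg_of_nonpos (pow_nonneg (recipSqrt_pos (hTneg t ht)).le _)
        (by linarith [(hT₁ t (hTle t ht)).1.2.1])
  have hL : IsSlowLowerPair 1 b (c * h) c T (critFst A B C (-1)) (critSnd G H c (-1)) := by
    refine ⟨fun t ht => ?_, tendsto_critFst, tendsto_critSnd, tendsto_critFst_div_exp hA0 hc,
      ⟨_, hDf (-1), fun t ht => ?_⟩, ⟨_, hDs (-1), fun t ht => ?_⟩⟩
    · have h1 := (hT₁ t (hTle t ht)).2.2
      exact ((div_pos_iff_of_pos_right (pow_pos (recipSqrt_pos (hTneg t ht)) 4)).1 h1).le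
    · have h1 := hE₂ t (hTneg t ht)
      have h2 : 0 ≤ recipSqrt t ^ 9 * (-(-1 * c / 2) + e₂ t) :=
        mul_nonneg (pow_nonneg (recipSqrt_pos (hTneg t ht)).le _)
          (by linarith [(hT₁ t (hTle t ht)).1.1.2])
      linarith
    · rw [hE₄ t (hTneg t ht)]
      exact mul_nonneg (pow_nonneg (recipSqrt_pos (hTneg t ht)).le _)
        (by linarith [(hT₁ t (hTle t ht)).1.2.2])
  obtain ⟨φ, θ, hfront, K, hK⟩ := exists_front_of_slow_pairs one_pos le_rfl hb hh hc
    (by rw [sub_self]; positivity) hf hU hL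
    (fun t ht => by
      have := pow_pos (recipSqrt_pos (hTneg t ht)) 7
      simp only [critFst]
      linarith)
    (fun t ht => by
      have := mul_pos hH0 (pow_pos (recipSqrt_pos (hTneg t ht)) 5)
      simp only [critSnd]
      linarith)
  -- `exp (c t / 2)` is smaller than every power of `1 / (-t)`, so the corrections disappear in the
  -- algebraic error terms.
  have hexp : ∀ n : ℕ, ∀ᶠ t in atBot, |K * Real.exp (c / 2 * t)| ≤ |K| * recipSqrt t ^ (2 * n) :=
    fun n => by
    filter_upwards [(tendsto_neg_pow_mul_exp_atBot n (half_pos hc)).eventually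
      (gt_mem_nhds one_pos), eventually_lt_atBot 0] with t ht ht0
    have hpos : 0 < (-t) ^ n := pow_pos (by linarith) n
    rw [abs_mul, abs_of_pos (Real.exp_pos _), pow_mul, recipSqrt_sq ht0, inv_pow]
    refine mul_le_mul_of_nonneg_left ?_ (abs_nonneg K)
    rw [← one_div, le_div_iff₀' hpos]
    exact ht.le
  have hR1 : ∀ᶠ t in atBot, recipSqrt t ≤ 1 :=
    (tendsto_recipSqrt.eventually (gt_mem_nhds one_pos)).mono fun _ h => le_of_lt h
  refine ⟨φ, θ, hfront, ?_, ?_⟩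
  · refine IsBigO.of_bound (|C| + 1 + |K|) ?_
    filter_upwards [hK, hexp 3, hR1, eventually_lt_atBot 0] with t ht he hR ht0
    have hRp := recipSqrt_pos ht0
    have ht2 : recipSqrt t ^ 4 = 1 / t ^ 2 := by
      rw [show recipSqrt t ^ 4 = (recipSqrt t ^ 2) ^ 2 by ring, recipSqrt_sq ht0]
      field_simp
    have ht3 : recipSqrt t ^ 6 = -(1 / t ^ 3) := by
      rw [show recipSqrt t ^ 6 = (recipSqrt t ^ 2) ^ 3 by ring, recipSqrt_sq ht0]
      field_simp
    have hnorm : ‖1 / t ^ 3‖ = recipSqrt t ^ 6 := by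
      rw [← norm_neg, ← ht3, Real.norm_eq_abs, abs_of_pos (by positivity)]
    have hmain : 2 * c ^ 2 / b / t ^ 2 - 8 * c / (3 * b) * (c ^ 2 * (1 + h + 1 / b) - 4) *
        (Real.log (-t) / t ^ 3) = A * recipSqrt t ^ 4 + B * Real.log (-t) * recipSqrt t ^ 6 := by
      have := ht0.ne
      rw [ht2, ht3, hBdef, hGdef, hAdef]
      field_simp
      ring
    rw [hnorm, hmain, Real.norm_eq_abs]
    have h1 := abs_le.1 he
    have h2 : recipSqrt t ^ 7 ≤ recipSqrt t ^ 6 := by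
      rw [pow_succ]
      exact mul_le_of_le_one_right (by positivity) hR
    have h3 : |C * recipSqrt t ^ 6| = |C| * recipSqrt t ^ 6 := by
      rw [abs_mul, abs_of_pos (pow_pos hRp 6)]
    have h4 := abs_le.1 h3.le
    have h5 := ht.1
    have h6 := ht.2.1
    simp only [critFst] at h5 h6
    rw [abs_le]
    constructor <;> linarith
  · refine IsBigO.of_bound (H + |K|) ?_
    filter_upwards [hK, hexp 2, hR1, eventually_lt_atBot 0] with t ht he hR ht0
    have hRp := recipSqrt_pos ht0
    have ht1 : recipSqrt t ^ 2 = -(1 / t) := by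
      rw [recipSqrt_sq ht0]
      field_simp
    have ht2 : recipSqrt t ^ 4 = 1 / t ^ 2 := by
      rw [show recipSqrt t ^ 4 = (recipSqrt t ^ 2) ^ 2 by ring, recipSqrt_sq ht0]
      field_simp
    have hnorm : ‖1 / t ^ 2‖ = recipSqrt t ^ 4 := by
      rw [← ht2, Real.norm_eq_abs, abs_of_pos (by positivity)]
    have hmain : 1 + 2 * c / t - G * (Real.log (-t) / t ^ 2) =
        1 - (2 * c * recipSqrt t ^ 2 + G * Real.log (-t) * recipSqrt t ^ 4) := by
      rw [ht1, ht2]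
      ring
    rw [hnorm, hmain, Real.norm_eq_abs]
    have h1 := abs_le.1 he
    have h2 : H * recipSqrt t ^ 5 ≤ H * recipSqrt t ^ 4 := by
      refine mul_le_mul_of_nonneg_left ?_ hH0.le
      rw [pow_succ]
      exact mul_le_of_le_one_right (by positivity) hR
    have h5 := ht.2.2.1
    have h6 := ht.2.2.2
    simp only [critSnd] at h5 h6
    rw [abs_le]
    constructor <;> linarith

/-! ### Assembling the three cases. -/

theorem theorem8 (r b h c : ℝ) (hr0 : 0 < r) (hr1 : r ≤ 1) (hb : 0 < b) (hh : 0 ≤ h)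
    (hc : 2 * Real.sqrt (1 - r) ≤ c) (hc' : c < cSharp r b h)
    (hf : 0 < bzF (c ^ 2) r b h) :
    ∃ φ θ : ℝ → ℝ, IsPositiveMonotoneFront r b h c φ θ ∧
      (r < 1 → 2 * Real.sqrt (1 - r) < c → HasExponentialAsymptotics r b h c φ θ) ∧
      (r = 1 → HasCriticalAsymptotics b h c φ θ) := by
  have hsq : Real.sqrt (1 - r) ^ 2 = 1 - r := Real.sq_sqrt (by linarith)
  have hs0 := Real.sqrt_nonneg (1 - r)
  rcases hr1.lt_or_eq with hr | rfl
  · have hspos : 0 < Real.sqrt (1 - r) := Real.sqrt_pos.2 (by linarith)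
    have hcpos : 0 < c := by linarith
    rcases hc.lt_or_eq with hlt | heq
    · obtain ⟨φ, θ, hfront, hasym⟩ := exists_front_exponential hr0 hr hb hh hcpos
        (by nlinarith) hf
      exact ⟨φ, θ, hfront, fun _ _ => hasym, fun h1 => absurd h1 hr.ne⟩
    · obtain ⟨φ, θ, hfront⟩ := exists_front_critical hr0 hr hb hh hcpos
        (by rw [← heq]; linarith) hf
      exact ⟨φ, θ, hfront, fun _ h1 => absurd heq h1.ne, fun h1 => absurd h1 hr.ne⟩
  · have hcpos : 0 < c := by
      -- For `r = 1` the speed bound gives only `c ≥ 0`. At `c = 0` every term of `bzF` vanishes,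
      -- because `Real.log 0 = 0`, which contradicts `hf`.
      refine lt_of_le_of_ne (by linarith) ?_
      rintro rfl
      simp [bzF] at hf
    obtain ⟨φ, θ, hfront, hasym⟩ := exists_front_algebraic hb hh hcpos hf
    exact ⟨φ, θ, hfront, fun h1 => absurd h1 (lt_irrefl 1), fun _ => hasym⟩
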